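/- Let $m\ge 2$, let $G=(\mathcal M,\mathcal E)$ be a tree on the set of terminals $\mathcal M=\{1,\dots,m\}$, and let $(V_{ij})_{e_{ij}\in\mathcal E}$, with $V_{ij}=V_{ji}$, be mutually independent discrete random variables, one for each edge. Terminal $j$ observes $X_j=(V_{ji} : i\in\Gamma(j))$, where $\Gamma(j)$ is the set of neighbours of $j$ in $G$ (a Tree-PIN). A wiretapper observes $Z=(Z_{ij})_{e_{ij}\in\mathcal E}$, where the $Z_{ij}$ are discrete and $P_{Z|X_{\mathcal M}}=\prod_{e_{ij}\in\mathcal E}P_{Z_{ij}|V_{ij}}$. A protocol on $n$ i.i.d. samples of $(X_1,\dots,X_m,Z)$ consists of finitely many rounds of noiseless public discussion, in each of which a terminal $j$ broadcasts a function of $X_j^n$ and of the previous messages; afterwards each terminal $j$ of a set $\mathcal A\subseteq\mathcal M$ outputs a function $K_j$ of $X_j^n$ and of the whole public communication $\mathbf F$. A key $K$, a function of $(X_1^n,\dots,X_m^n)$ with values in a finite alphabet $\mathcal K$, is an $(\epsilon,\sigma)$-secret key for $\mathcal A$ if for some protocol $\Pr[K_j=K]\ge 1-\epsilon$ for all $j\in\mathcal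 A$, and the statistical distance between $(K,\mathbf F,Z^n)$ and $(U,\mathbf F,Z^n)$ is at most $\sigma$, where $U$ is uniform on $\mathcal K$ and independent of $(\mathbf F,Z^n)$. Its length is $\log_2|\mathcal K|$. Let $S_{\epsilon,\sigma}(X^n_{\mathcal A}\|Z^n)$ be the supremum of the lengths of all $(\epsilon,\sigma)$-secret keys for $\mathcal A$, and let the wiretap secret key capacity be $$C_{WSK}(X_{\mathcal A}\|Z)=\sup_{(\epsilon_n),(\sigma_n)}\ \liminf_{n\to\infty}\frac1n\,S_{\epsilon_n,\sigma_n}(X^n_{\mathcal A}\|Z^n),$$ the supremum being over all positive sequences with $\lim_{n\to\infty}(\epsilon_n+\sigma_n)=0$. Then for every $\mathcal A\subseteq\mathcal M$ with $|\mathcal A|\ge 2$ (in particular for $\mathcal A=\mathcal M$), $$C_{WSK}(X_{\mathcal A}\|Z)=\min_{e_{ij}\in T(\mathcal A)}H(V_{ij}\mid Z),$$ where $T(\mathcal A)$ is the smallest subtree of $G$ (the one with the least number of nodes) that contains all nodes of $\mathcal A$, the minimum is over the edges of $T(\mathcal A)$, and $H(\cdot\mid\cdot)$ is the conditional Shannon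 entropy in bits (both sides are elements of $[0,\infty]$). -/

import Mathlib

open MeasureTheory ProbabilityTheory Filter
open scoped ENNReal Topology

noncomputable section

namespace TreePIN

/-- Shannon entropy, in bits and with values in `[0, ∞]`, of a discrete random variable `U`
under the probability measure `ν`. -/
def entropy {Ω α : Type*} [MeasurableSpace Ω] (ν : Measure Ω) (U : Ω → α) : ℝ≥0∞ :=
  ∑' u, ENNReal.ofReal (Real.negMulLog (ν.real {ω | U ω = u}) / Real.log 2)

/-- Conditional Shannon entropy `H(U | W) = ∑ w, P(W = w) H(U | W = w)` of discrete random
variables, in bits and with values in `[0, ∞]`. -/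
def condEntropy {Ω α β : Type*} [MeasurableSpace Ω] (μ : Measure Ω) (U : Ω → α) (W : Ω → β) :
    ℝ≥0∞ :=
  ∑' w, μ {ω | W ω = w} * entropy (cond μ {ω | W ω = w}) U

/-- Statistical distance `(1 / 2) ∑ w, |p w - q w|` of two probability mass functions. -/
def statDist {α : Type*} (p q : α → ℝ) : ℝ≥0∞ :=
  (∑' w, ENNReal.ofReal |p w - q w|) / 2

/-- A protocol with public discussion in which terminal `j` observes `n` letters of the alphabet
`𝒳 j` and every terminal of `A` outputs a value in `Fin k`.  There are finitely many rounds; in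
round `t` the terminal `speaker t` broadcasts a message (from a countable alphabet) that is a
function of its own observations and of the list of all previous public messages.  The outputs are
functions of the own observations and of the whole public communication. -/
structure Protocol {m : ℕ} (𝒳 : Fin m → Type*) (A : Finset (Fin m)) (n k : ℕ) where
  rounds : ℕ
  speaker : Fin rounds → Fin m
  message : (t : Fin rounds) → (Fin n → 𝒳 (speaker t)) → List ℕ → ℕ
  output : (j : A) → (Fin n → 𝒳 j) → List ℕ → Fin k

/-- The list of the messages of the first `t` rounds (and of all rounds, if `t` exceeds their
number), when terminal `j` observes `x j`. -/
def Protocol.messages {m : ℕ} {𝒳 : Fin m → Type*} {A : Finset (Fin m)} {n k : ℕ}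
    (π : Protocol 𝒳 A n k) (x : (j : Fin m) → Fin n → 𝒳 j) : ℕ → List ℕ
  | 0 => []
  | t + 1 =>
    if h : t < π.rounds then
      π.messages x t ++ [π.message ⟨t, h⟩ (x (π.speaker ⟨t, h⟩)) (π.messages x t)]
    else π.messages x t

/-- The whole public communication of a protocol. -/
def Protocol.transcript {m : ℕ} {𝒳 : Fin m → Type*} {A : Finset (Fin m)} {n k : ℕ}
    (π : Protocol 𝒳 A n k) (x : (j : Fin m) → Fin n → 𝒳 j) : List ℕ :=
  π.messages x π.rounds

section Source

variable {Ω : Type*} [MeasurableSpace Ω] {m : ℕ} {𝒳 : Fin m → Type*} {𝒵 : Type*}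

/-- The observations of all the terminals in `n` samples of the source: terminal `j` observes
`X j (ω 0), …, X j (ω (n - 1))`.  Under `Measure.pi (fun _ : Fin n => μ)` the samples are
independent and identically distributed. -/
def samples (X : (j : Fin m) → Ω → 𝒳 j) {n : ℕ} (ω : Fin n → Ω) (j : Fin m) : Fin n → 𝒳 j :=
  fun i => X j (ω i)

/-- The key `K`, a function of the observations of all terminals with values in the alphabet
`Fin k`, is an `(ε, σ)`-secret key for the terminals in `A`, established by the protocol `π` from
`n` independent samples of the source `(X, Z)`: every terminal of `A` outputs `K` with probability
at least `1 - ε`, and `(K, F, Zⁿ)` has statistical distance at most `σ` from `(U, F, Zⁿ)`, where `F`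
is the public communication and `U` is uniform on `Fin k` and independent of `(F, Zⁿ)`. -/
structure IsSecretKey (μ : Measure Ω) (X : (j : Fin m) → Ω → 𝒳 j) (Z : Ω → 𝒵)
    (A : Finset (Fin m)) (ε σ : ℝ) {n k : ℕ} (π : Protocol 𝒳 A n k)
    (K : ((j : Fin m) → Fin n → 𝒳 j) → Fin k) : Prop where
  reliability : ∀ j : A,
    1 - ε ≤ (Measure.pi fun _ : Fin n => μ).real
      {ω | π.output j (samples X ω j) (π.transcript (samples X ω)) = K (samples X ω)}
  secrecy :
    statDist
      (fun w : Fin k × List ℕ × (Fin n → 𝒵) =>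
        (Measure.pi fun _ : Fin n => μ).real
          {ω | K (samples X ω) = w.1 ∧ π.transcript (samples X ω) = w.2.1 ∧
            (fun i => Z (ω i)) = w.2.2})
      (fun w : Fin k × List ℕ × (Fin n → 𝒵) =>
        (1 / (k : ℝ)) * (Measure.pi fun _ : Fin n => μ).real
          {ω | π.transcript (samples X ω) = w.2.1 ∧ (fun i => Z (ω i)) = w.2.2})
      ≤ ENNReal.ofReal σ

/-- The supremum of the lengths `log₂ k`, in bits, of all `(ε, σ)`-secret keys for `A` that can be
established from `n` independent samples of the source; `k` is the size of the key alphabet. -/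
def maxKeyLength (μ : Measure Ω) (X : (j : Fin m) → Ω → 𝒳 j) (Z : Ω → 𝒵)
    (A : Finset (Fin m)) (n : ℕ) (ε σ : ℝ) : ℝ≥0∞ :=
  ⨆ (k : ℕ) (_ : 1 ≤ k ∧ ∃ (π : Protocol 𝒳 A n k) (K : ((j : Fin m) → Fin n → 𝒳 j) → Fin k),
    IsSecretKey μ X Z A ε σ π K), ENNReal.ofReal (Real.logb 2 k)

/-- The wiretap secret key capacity, in bits per sample, for the terminals in `A`. -/
def wskCapacity (μ : Measure Ω) (X : (j : Fin m) → Ω → 𝒳 j) (Z : Ω → 𝒵)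
    (A : Finset (Fin m)) : ℝ≥0∞ :=
  ⨆ (ε : ℕ → ℝ) (σ : ℕ → ℝ)
    (_ : (∀ n, 0 < ε n) ∧ (∀ n, 0 < σ n) ∧ Tendsto (fun n => ε n + σ n) atTop (𝓝 0)),
    liminf (fun n : ℕ => maxKeyLength μ X Z A n (ε n) (σ n) / (n : ℝ≥0∞)) atTop

end Source

section Tree

variable {Ω : Type*} {m : ℕ} (G : SimpleGraph (Fin m))

/-- The variable of terminal `j` in a pairwise independent network on the graph `G`: the tuple of
the edge variables `V_{ji}`, where `i` runs over the neighbours of `j`. -/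
def terminalVar {𝒱 : G.edgeSet → Type*} (V : (e : G.edgeSet) → Ω → 𝒱 e) (j : Fin m) (ω : Ω)
    (i : G.neighborSet j) : 𝒱 ⟨s(j, (i : Fin m)), i.2⟩ :=
  V ⟨s(j, (i : Fin m)), i.2⟩ ω

/-- The wiretapped Tree-PIN model: `G` is a tree, the edge variables are mutually independent, and
the wiretapper's variable `Z = (Z e)` satisfies `P_{Z | V} = ∏ e, P_{Z e | V e}`. -/
structure IsWiretappedTreePIN [MeasurableSpace Ω] [Fintype G.edgeSet] (μ : Measure Ω)
    {𝒱 𝒵 : G.edgeSet → Type*}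
    [∀ e, MeasurableSpace (𝒱 e)] (V : (e : G.edgeSet) → Ω → 𝒱 e)
    (Z : (e : G.edgeSet) → Ω → 𝒵 e) : Prop where
  isTree : G.IsTree
  indep : iIndepFun V μ
  factor : ∀ (v : (e : G.edgeSet) → 𝒱 e) (z : (e : G.edgeSet) → 𝒵 e),
    μ {ω | ∀ e, V e ω = v e} ≠ 0 →
      cond μ {ω | ∀ e, V e ω = v e} {ω | ∀ e, Z e ω = z e} =
        ∏ e, cond μ {ω | V e ω = v e} {ω | Z e ω = z e}

/-- `T` is a subtree of `G` that contains all the nodes of `A`, with the least number of nodes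
among all such subtrees. -/
structure IsSmallestSubtree (A : Finset (Fin m)) (T : G.Subgraph) : Prop where
  isTree : T.coe.IsTree
  subset : (A : Set (Fin m)) ⊆ T.verts
  least : ∀ T' : G.Subgraph, T'.coe.IsTree → (A : Set (Fin m)) ⊆ T'.verts →
    T.verts.ncard ≤ T'.verts.ncard

end Tree

end TreePIN

end

/-!
**Canonical model.** The factorization of `P_{Z | V}` and the independence of the `V_e` make the
pairs `(V_e, Z_e)` independent (`measure_pairs_eq_prod`). Hence `n` samples of the source amount to
a point of `∀ e, Fin n → 𝒱 e × 𝒵 e` under a product measure (`isSecretKey_iff`), all events live on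
a countable discrete space, and `H(V_e | Z)` is the mean of the conditional information density
`-log₂ P(V_e | Z_e)` (`condEntropy_edge`). The weak law of large numbers therefore gives the
asymptotic equipartition property in the two one-sided forms that are needed, valid also for
infinite entropy.

**Converse.** Removing an edge `e` of `T` leaves terminals of `A` on both sides, because otherwise
`T` would not be smallest (`exists_separating_set`). Given `V_e^n`, `Z^n` and the public
communication `F`, the observations on the two sides are independent: a transcript fixes a
rectangle (`Protocol.messages_paste`). Two conditionally independent estimates that agree with high
probability are nearly deterministic (`exists_guess`), so the key is, up to a small probability, a
function of `(V_e^n, Z^n, F)`. As `V_e^n` lies in a set of at most `2^(n r)` sequences that depends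
on `Z^n` only, for any `r > H(V_e | Z)`, the key lies in a set of at most `2^(n r)` values
determined by `(F, Z^n)`, and secrecy bounds the probability of that by `2^(n r) / k` up to a
multiple of `σ` (`converse_bound`). No entropy inequality is needed.

**Achievability.** Both ends of an edge `e` of `T` hash `V_e^n` to `S_e ∈ Fin k` with
`k ≈ 2^(n R)`, `R < H(V_e | Z)`; a good hash function is found by a derandomized second-moment
argument (`exists_hash_sum_sq_le`), and makes the law of `(S_e, Z_e^n)` almost invariant under
translations of `S_e` (`exists_tendsto_hash`). Every terminal publishes the differences of the `S_e`
on its edges of `T`. Since `T` is connected, each terminal can then compute every `S_e`, in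
particular the key `S_{e₀}`. Translating all `S_e` by the same amount changes the key but not the
communication, so a hybrid argument over the edges (`pi_le_pi_add_sum`) gives secrecy
(`statDist_key_le_of_shift`).
-/

namespace TreePIN

/-! ### Product measures, discrete laws and the weak law of large numbers -/

/-- Replacing one factor of a product of probability measures amounts to resampling that coordinate.
-/
theorem pi_update_apply {ι : Type*} [Fintype ι] [DecidableEq ι] {β : ι → Type*}
    [∀ i, MeasurableSpace (β i)] (P : ∀ i, Measure (β i)) [∀ i, IsProbabilityMeasure (P i)]
    (i : ι) (ν : Measure (β i)) [IsProbabilityMeasure ν] {B : Set (∀ i, β i)}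
    (hB : MeasurableSet B) :
    Measure.pi (Function.update P i ν) B =
      ∫⁻ x, ν {y | Function.update x i y ∈ B} ∂Measure.pi P := by
  have hp : ∀ j, IsProbabilityMeasure (Function.update P i ν j) := by
    intro j
    by_cases h : j = i
    · subst h; simpa
    · rw [Function.update_of_ne h]; infer_instance
  have hm : Measurable fun p : (∀ i, β i) × β i => Function.update p.1 i p.2 := by
    refine measurable_pi_lambda _ fun j => ?_
    by_cases h : j = i
    · subst h; simpa using measurable_snd
    · simpa [h] using (by fun_prop : Measurable fun p : (∀ i, β i) × β i => p.1 j)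
  have key : Measure.pi (Function.update P i ν) =
      ((Measure.pi P).prod ν).map fun p => Function.update p.1 i p.2 := by
    refine Measure.pi_eq fun s hs => ?_
    rw [Measure.map_apply hm (MeasurableSet.univ_pi hs)]
    have : (fun p : (∀ i, β i) × β i => Function.update p.1 i p.2) ⁻¹' Set.univ.pi s =
        Set.univ.pi (Function.update s i Set.univ) ×ˢ s i := by
      ext ⟨x, y⟩
      simp only [Set.mem_preimage, Set.mem_pi, Set.mem_univ, true_implies, Set.mem_prod]
      constructor
      · intro h
        refine ⟨fun j => ?_, by simpa using h i⟩
        by_cases hj : j = i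
        · subst hj; simp
        · simpa [hj] using h j
      · rintro ⟨h, h'⟩ j
        by_cases hj : j = i
        · subst hj; simpa using h'
        · simpa [hj] using h j
    rw [this, Measure.prod_prod, Measure.pi_pi, ← Finset.mul_prod_erase _ _ (Finset.mem_univ i),
      ← Finset.mul_prod_erase _ _ (Finset.mem_univ i)]
    simp only [Function.update_self, measure_univ, one_mul]
    rw [mul_comm]
    congr 1
    refine Finset.prod_congr rfl fun j hj => ?_
    have hj : j ≠ i := (Finset.mem_erase.1 hj).1
    simp [hj]
  rw [key, Measure.map_apply hm hB, Measure.prod_apply (hm hB)]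
  rfl

/-- Hybrid argument: closeness of measures, in the form `P B ≤ Q B + δ` for all `B`, is subadditive
under products. The factors are replaced one at a time. -/
theorem pi_le_pi_add_sum {ι : Type*} [Fintype ι] {β : ι → Type*}
    [∀ i, MeasurableSpace (β i)] (P Q : ∀ i, Measure (β i)) [∀ i, IsProbabilityMeasure (P i)]
    [∀ i, IsProbabilityMeasure (Q i)] (δ : ι → ℝ≥0∞)
    (h : ∀ i B, MeasurableSet B → P i B ≤ Q i B + δ i) {B : Set (∀ i, β i)}
    (hB : MeasurableSet B) : Measure.pi P B ≤ Measure.pi Q B + ∑ i, δ i := by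
  classical
  have main : ∀ s : Finset ι, Measure.pi (fun i => if i ∈ s then P i else Q i) B ≤
      Measure.pi Q B + ∑ i ∈ s, δ i := by
    intro s
    induction s using Finset.induction_on with
    | empty => simp
    | insert a s ha ih =>
      set M : ∀ i, Measure (β i) := fun i => if i ∈ s then P i else Q i with hM
      have hMp : ∀ i, IsProbabilityMeasure (M i) := by
        intro i; simp only [hM]; split_ifs <;> infer_instance
      have e1 : (fun i => if i ∈ insert a s then P i else Q i) = Function.update M a (P a) := by
        ext1 i
        by_cases hi : i = a
        · subst hi; simp
        · simp [hi, hM]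
      have e2 : M = Function.update M a (Q a) := by
        symm; rw [Function.update_eq_self_iff]; simp [hM, ha]
      rw [e1, pi_update_apply M a (P a) hB, Finset.sum_insert ha]
      have hsec : ∀ x : ∀ i, β i, MeasurableSet {y | Function.update x a y ∈ B} :=
        fun x => measurable_update x hB
      calc ∫⁻ x, P a {y | Function.update x a y ∈ B} ∂Measure.pi M
          ≤ ∫⁻ x, (Q a {y | Function.update x a y ∈ B} + δ a) ∂Measure.pi M :=
            lintegral_mono fun x => h a _ (hsec x)
        _ = ∫⁻ x, Q a {y | Function.update x a y ∈ B} ∂Measure.pi M + δ a := by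
            rw [lintegral_add_right _ measurable_const]; simp
        _ = Measure.pi M B + δ a := by
            rw [← pi_update_apply M a (Q a) hB, ← e2]
        _ ≤ Measure.pi Q B + (∑ i ∈ s, δ i) + δ a := by gcongr
        _ = _ := by rw [add_comm (δ a), add_assoc]
  simpa using main Finset.univ

section Countable

theorem ofReal_measureReal_sub {α : Type*} [MeasurableSpace α] (P Q : Measure α)
    [IsFiniteMeasure P] [IsFiniteMeasure Q] (w : α) :
    ENNReal.ofReal (P.real {w} - Q.real {w}) = P {w} - Q {w} := by
  rw [ENNReal.ofReal_sub _ measureReal_nonneg, ofReal_measureReal, ofReal_measureReal]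

variable {α : Type*} [Countable α] [MeasurableSpace α] [DiscreteMeasurableSpace α]

theorem measure_eq_tsum_singleton (P : Measure α) (B : Set α) : P B = ∑' w : B, P {(w : α)} := by
  rw [← measure_biUnion B.to_countable (fun x _ y _ h => by simpa [Function.onFun] using h)
    (fun _ _ => MeasurableSet.of_discrete)]
  simp

theorem tsum_tsub_le (P Q : Measure α) [IsFiniteMeasure Q] {δ : ℝ≥0∞} (h : ∀ B, P B ≤ Q B + δ) :
    ∑' w, (P {w} - Q {w}) ≤ δ := by
  set B : Set α := {w | Q {w} ≤ P {w}}
  have h1 : ∑' w, (P {w} - Q {w}) = ∑' w : B, (P {(w : α)} - Q {(w : α)}) := by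
    rw [tsum_subtype B fun w => P {w} - Q {w}]
    refine tsum_congr fun w => ?_
    by_cases hw : w ∈ B
    · simp [hw]
    · rw [Set.indicator_of_notMem hw]
      exact tsub_eq_zero_of_le (le_of_lt (not_le.1 hw))
  have h2 : ∑' w : B, (P {(w : α)} - Q {(w : α)}) + Q B = P B := by
    rw [measure_eq_tsum_singleton Q B, measure_eq_tsum_singleton P B, ← ENNReal.tsum_add]
    exact tsum_congr fun w => tsub_add_cancel_of_le w.2
  have h3 := h B
  rw [← h2, add_comm (Q B)] at h3
  rw [h1]
  exact (ENNReal.add_le_add_iff_right (measure_ne_top Q B)).1 h3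

variable (P Q : Measure α) [IsFiniteMeasure P] [IsFiniteMeasure Q]

/-- Closeness on all events bounds the `ℓ¹` distance of the mass functions: sum `P - Q` over the set
where it is positive. -/
theorem tsum_ofReal_abs_sub_le {δ : ℝ≥0∞} (h : ∀ B, P B ≤ Q B + δ) (h' : ∀ B, Q B ≤ P B + δ) :
    ∑' w, ENNReal.ofReal |P.real {w} - Q.real {w}| ≤ 2 * δ := by
  have : ∀ w, ENNReal.ofReal |P.real {w} - Q.real {w}| ≤
      (P {w} - Q {w}) + (Q {w} - P {w}) := by
    intro w
    rw [← ofReal_measureReal_sub, ← ofReal_measureReal_sub]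
    rcases abs_cases (P.real {w} - Q.real {w}) with h | h
    · rw [h.1]; exact le_self_add
    · rw [h.1, neg_sub]; exact le_add_self
  calc _ ≤ _ := ENNReal.tsum_le_tsum this
    _ = _ := ENNReal.tsum_add
    _ ≤ δ + δ := add_le_add (tsum_tsub_le P Q h) (tsum_tsub_le Q P h')
    _ = _ := (two_mul δ).symm

theorem measure_le_add_tsum (B : Set α) :
    P B ≤ Q B + ∑' w, ENNReal.ofReal |P.real {w} - Q.real {w}| := by
  rw [measure_eq_tsum_singleton P B, measure_eq_tsum_singleton Q B]
  calc ∑' w : B, P {(w : α)}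
      ≤ ∑' w : B, (Q {(w : α)} + ENNReal.ofReal |P.real {(w : α)} - Q.real {(w : α)}|) := by
        refine ENNReal.tsum_le_tsum fun w => ?_
        rw [← tsub_le_iff_left, ← ofReal_measureReal_sub]
        exact ENNReal.ofReal_le_ofReal (le_abs_self _)
    _ = _ := ENNReal.tsum_add
    _ ≤ _ := by
        gcongr
        exact ENNReal.tsum_comp_le_tsum_of_injective Subtype.val_injective
          fun w => ENNReal.ofReal |P.real {w} - Q.real {w}|

theorem exists_finset_measure_compl_le (P : Measure α) [IsFiniteMeasure P] {ε : ℝ≥0∞} (hε : ε ≠ 0) :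
    ∃ s : Finset α, P (s : Set α)ᶜ ≤ ε := by
  have hs : ∑' w, P {w} ≠ ∞ := by
    have := measure_eq_tsum_singleton P Set.univ
    rw [tsum_univ (fun w => P {w})] at this
    rw [← this]; exact measure_ne_top _ _
  have := ENNReal.tendsto_tsum_compl_atTop_zero hs
  obtain ⟨s, hs⟩ := ((ENNReal.tendsto_nhds_zero.1 this) ε hε.bot_lt).exists
  refine ⟨s, ?_⟩
  rw [measure_eq_tsum_singleton]
  exact hs

end Countable

/-- The lower half of the weak law of large numbers on the finite products themselves. It is
transferred from the strong law on the infinite product. -/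
theorem tendsto_pi_sum_lt {Ω : Type*} [MeasurableSpace Ω] (μ : Measure Ω) [IsProbabilityMeasure μ]
    {g : Ω → ℝ} (hm : Measurable g) (hg : Integrable g μ) {r : ℝ} (hr : r < ∫ x, g x ∂μ) :
    Tendsto (fun n : ℕ => (Measure.pi fun _ : Fin n => μ)
      {ω | ∑ i, g (ω i) < n * r}) atTop (𝓝 0) := by
  set P := Measure.infinitePi fun _ : ℕ => μ
  have hind : iIndepFun (fun (i : ℕ) (ω : ℕ → Ω) => ω i) P :=
    iIndepFun_infinitePi (P := fun _ : ℕ => μ) (X := fun _ x => x) (fun _ => measurable_id)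
  have hmap : ∀ i : ℕ, P.map (fun ω => ω i) = μ := fun i =>
    Measure.infinitePi_map_eval (μ := fun _ : ℕ => μ) i
  have hlaw : ∀ n : ℕ, P.map (fun ω (i : Fin n) => ω i) = Measure.pi fun _ : Fin n => μ := by
    intro n
    have h1 : iIndepFun (fun (i : Fin n) (ω : ℕ → Ω) => ω (i : ℕ)) P :=
      hind.precomp Fin.val_injective
    have h2 := (iIndepFun_iff_map_fun_eq_pi_map
      fun i : Fin n => (measurable_pi_apply (i : ℕ)).aemeasurable).1 h1
    simp_rw [hmap] at h2
    exact h2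
  have hae := strong_law_ae_real (μ := P) (fun i ω => g (ω i))
    (by
      have : Integrable g (P.map fun ω => ω 0) := by rwa [hmap]
      exact this.comp_measurable (measurable_pi_apply 0))
    (fun i j hij => (hind.indepFun hij).comp hm hm)
    (fun i => by
      refine IdentDistrib.comp (f := fun ω : ℕ → Ω => ω i) (g := fun ω : ℕ → Ω => ω 0) ?_ hm
      exact ⟨(measurable_pi_apply i).aemeasurable, (measurable_pi_apply 0).aemeasurable,
        by rw [hmap, hmap]⟩)
  have hE : ∫ ω, g (ω 0) ∂P = ∫ x, g x ∂μ := by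
    conv_rhs => rw [← hmap 0]
    rw [integral_map (measurable_pi_apply 0).aemeasurable hm.aestronglyMeasurable]
  simp only [hE] at hae
  have hset : ∀ n : ℕ, (Measure.pi fun _ : Fin n => μ) {ω | ∑ i, g (ω i) < n * r} =
      P {ω | ∑ i ∈ Finset.range n, g (ω i) < n * r} := by
    intro n
    rw [← hlaw, Measure.map_apply (by fun_prop)
      (measurableSet_lt (by fun_prop) (by fun_prop))]
    congr 1
    ext ω
    simp [Finset.sum_range]
  simp_rw [hset]
  have := tendsto_measure_of_ae_tendsto_indicator_of_isFiniteMeasure (μ := P) (L := atTop)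
    (A := ∅) (As := fun n : ℕ => {ω | ∑ i ∈ Finset.range n, g (ω i) < n * r})
    MeasurableSet.empty (fun n => measurableSet_lt (by fun_prop) (by fun_prop)) ?_
  · simpa using this
  filter_upwards [hae] with ω hω
  filter_upwards [hω.eventually_const_lt hr, eventually_gt_atTop 0] with n hn hn0
  have : (0 : ℝ) < n := by exact_mod_cast hn0
  rw [lt_div_iff₀ this] at hn
  simp only [Set.mem_empty_iff_false, iff_false]
  refine not_lt.2 ?_
  linarith

/-! ### Hashing and guessing -/

/-- The second-moment step of the hashing argument: averaged over `t`, the cross terms vanish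
because `𝟙[t = s] - 1 / k` has mean zero. -/
theorem sum_sum_sq_add_mul_le {k : ℕ} [NeZero k] (a : Fin k → ℝ) (x : ℝ) :
    ∑ t : Fin k, ∑ s : Fin k, (a s + x * ((if t = s then (1 : ℝ) else 0) - 1 / (k : ℝ))) ^ 2 ≤
      k * (∑ s, a s ^ 2 + x ^ 2) := by
  have hk : (k : ℝ) ≠ 0 := NeZero.ne _
  have h0 : ∀ s : Fin k, ∑ t : Fin k, ((if t = s then (1 : ℝ) else 0) - 1 / (k : ℝ)) = 0 := by
    intro s; simp [Finset.sum_sub_distrib, hk]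
  have h1 : ∀ s : Fin k, ∑ t : Fin k, ((if t = s then (1 : ℝ) else 0) - 1 / (k : ℝ)) ^ 2 =
      1 - 1 / (k : ℝ) := by
    intro s
    have : ∀ t : Fin k, ((if t = s then (1 : ℝ) else 0) - 1 / (k : ℝ)) ^ 2 =
        (if t = s then 1 - 2 / (k : ℝ) else 0) + 1 / (k : ℝ) ^ 2 := by
      intro t; split_ifs <;> ring
    simp only [this, Finset.sum_add_distrib, Finset.sum_ite_eq', Finset.mem_univ, if_true,
      Finset.sum_const, Finset.card_univ, Fintype.card_fin, nsmul_eq_mul]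
    field_simp; ring
  have h2 : ∀ s : Fin k,
      ∑ t : Fin k, (a s + x * ((if t = s then (1 : ℝ) else 0) - 1 / (k : ℝ))) ^ 2 =
      k * a s ^ 2 + x ^ 2 * (1 - 1 / k) := by
    intro s
    have : ∀ t : Fin k, (a s + x * ((if t = s then (1 : ℝ) else 0) - 1 / (k : ℝ))) ^ 2 =
        a s ^ 2 + 2 * a s * x * ((if t = s then (1 : ℝ) else 0) - 1 / (k : ℝ)) +
        x ^ 2 * ((if t = s then (1 : ℝ) else 0) - 1 / (k : ℝ)) ^ 2 := by
      intro t; ring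
    simp only [this, Finset.sum_add_distrib, ← Finset.mul_sum, h0, h1]
    simp
  rw [Finset.sum_comm]
  simp only [h2, Finset.sum_add_distrib, ← Finset.mul_sum]
  simp only [Finset.sum_const, Finset.card_univ, Fintype.card_fin, nsmul_eq_mul]
  have : (k : ℝ) * (x ^ 2 * (1 - 1 / k)) ≤ k * x ^ 2 := by
    have : (0 : ℝ) ≤ x ^ 2 := sq_nonneg x
    have h4 : (k : ℝ) * (x ^ 2 * (1 - 1 / k)) = k * x ^ 2 - x ^ 2 := by field_simp
    linarith
  linarith

/-- Greedy derandomization: the values of `h` are chosen one after another, each at most as bad as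
the average over all values, so that the second moments of the deviations from uniformity add up. -/
theorem exists_hash_sum_sq_le {𝒱 𝒵 : Type*} {k : ℕ} [NeZero k] (S : Finset 𝒱) (T : Finset 𝒵)
    (c : 𝒵 → ℝ) (hc : ∀ z, 0 ≤ c z) (q : 𝒱 → 𝒵 → ℝ) :
    ∃ h : 𝒱 → Fin k, ∑ z ∈ T, c z * ∑ s,
        (∑ v ∈ S, q v z * ((if h v = s then 1 else 0) - 1 / (k : ℝ))) ^ 2 ≤
      ∑ z ∈ T, c z * ∑ v ∈ S, q v z ^ 2 := by
  classical
  induction S using Finset.induction_on with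
  | empty => exact ⟨fun _ => 0, by simp⟩
  | insert v₀ S hv ih =>
    obtain ⟨h, hh⟩ := ih
    set a : 𝒵 → Fin k → ℝ := fun z s =>
      ∑ v ∈ S, q v z * ((if h v = s then 1 else 0) - 1 / (k : ℝ)) with ha
    set Φ : Fin k → ℝ := fun t => ∑ z ∈ T, c z * ∑ s,
      (a z s + q v₀ z * ((if t = s then (1 : ℝ) else 0) - 1 / (k : ℝ))) ^ 2 with hΦ
    have hsum : ∑ t, Φ t ≤ ∑ _t : Fin k, ∑ z ∈ T, c z * (∑ s, a z s ^ 2 + q v₀ z ^ 2) := by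
      rw [Finset.sum_comm, Finset.sum_const, Finset.card_univ, Fintype.card_fin, nsmul_eq_mul,
        Finset.mul_sum]
      refine Finset.sum_le_sum fun z _ => ?_
      rw [← Finset.mul_sum]
      calc _ ≤ c z * (k * (∑ s, a z s ^ 2 + q v₀ z ^ 2)) :=
            mul_le_mul_of_nonneg_left (sum_sum_sq_add_mul_le _ _) (hc z)
        _ = _ := by ring
    obtain ⟨t, -, ht⟩ := Finset.exists_le_of_sum_le ⟨0, Finset.mem_univ _⟩ hsum
    refine ⟨Function.update h v₀ t, ?_⟩
    have e1 : ∀ z s, ∑ v ∈ insert v₀ S,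
        q v z * ((if Function.update h v₀ t v = s then 1 else 0) - 1 / (k : ℝ)) =
        a z s + q v₀ z * ((if t = s then (1 : ℝ) else 0) - 1 / (k : ℝ)) := by
      intro z s
      rw [Finset.sum_insert hv, add_comm, Function.update_self]
      congr 1
      refine Finset.sum_congr rfl fun v hv' => ?_
      rw [Function.update_of_ne (fun h' => hv (by rwa [← h']))]
    simp only [e1]
    refine ht.trans ?_
    simp only [mul_add, Finset.sum_add_distrib, Finset.sum_insert hv]
    rw [add_comm]
    gcongr

/-- From the weighted second moment to an `ℓ¹` bound by Cauchy–Schwarz, where `r` is the marginal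
mass function and `c` bounds the conditional probabilities on `B`. -/
theorem exists_hash_sum_abs_le {𝒱 𝒵 : Type*} [DecidableEq 𝒱] [DecidableEq 𝒵] {k : ℕ} [NeZero k]
    (p : 𝒱 × 𝒵 → ℝ) (hp : ∀ x, 0 ≤ p x) (r : 𝒵 → ℝ) (hr : ∀ z, 0 ≤ r z)
    (B : Finset (𝒱 × 𝒵)) (hB : ∑ x ∈ B, p x ≤ 1) (hr1 : ∑ z ∈ B.image Prod.snd, r z ≤ 1)
    {c : ℝ} (hc : ∀ x ∈ B, p x ≤ c * r x.2) (hc0 : 0 ≤ c) :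
    ∃ h : 𝒱 → Fin k, ∀ f : Fin k → 𝒵 → ℝ, (∀ s z, |f s z| ≤ 1) →
      ∑ x ∈ B, p x * ∑ s, ((if h x.1 = s then 1 else 0) - 1 / (k : ℝ)) * f s x.2 ≤
        √(k * c) := by
  set S := B.image Prod.fst
  set T := B.image Prod.snd
  set q : 𝒱 → 𝒵 → ℝ := fun v z => if (v, z) ∈ B then p (v, z) else 0 with hq
  have hBsub : B ⊆ S ×ˢ T := fun x hx => Finset.mem_product.2
    ⟨Finset.mem_image_of_mem _ hx, Finset.mem_image_of_mem _ hx⟩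
  have hqle : ∀ v z, q v z ^ 2 ≤ r z * (q v z * c) := by
    intro v z
    simp only [hq]
    split_ifs with h
    · have := hc _ h
      simp only at this
      nlinarith [hp (v, z)]
    · simp
  obtain ⟨h, hh⟩ := exists_hash_sum_sq_le (k := k) S T (fun z => (r z)⁻¹)
    (fun z => inv_nonneg.2 (hr z)) q
  refine ⟨h, fun f hf => ?_⟩
  set a : 𝒵 → Fin k → ℝ := fun z s =>
    ∑ v ∈ S, q v z * ((if h v = s then 1 else 0) - 1 / (k : ℝ)) with ha
  have hq0 : ∀ v z, r z = 0 → q v z = 0 := by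
    intro v z hz
    have := hqle v z
    rw [hz, zero_mul] at this
    exact pow_eq_zero_iff (two_ne_zero) |>.1 (le_antisymm this (sq_nonneg _))
  have h1 : ∑ x ∈ B, p x * ∑ s, ((if h x.1 = s then 1 else 0) - 1 / (k : ℝ)) * f s x.2 =
      ∑ z ∈ T, ∑ s, a z s * f s z := by
    have : ∑ x ∈ B, p x * ∑ s, ((if h x.1 = s then 1 else 0) - 1 / (k : ℝ)) * f s x.2 =
        ∑ x ∈ S ×ˢ T, q x.1 x.2 *
          ∑ s, ((if h x.1 = s then 1 else 0) - 1 / (k : ℝ)) * f s x.2 := by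
      rw [← Finset.sum_subset hBsub]
      · exact Finset.sum_congr rfl fun x hx => by simp [hq, hx]
      · intro x _ hx; simp [hq, hx]
    rw [this, Finset.sum_product_right]
    refine Finset.sum_congr rfl fun z _ => ?_
    simp only [ha, Finset.mul_sum, Finset.sum_mul]
    rw [Finset.sum_comm]
    exact Finset.sum_congr rfl fun s _ => Finset.sum_congr rfl fun v _ => by ring
  have h2 : ∑ z ∈ T, ∑ s, a z s * f s z ≤ ∑ x ∈ T ×ˢ (Finset.univ : Finset (Fin k)),
      |a x.1 x.2| := by
    rw [Finset.sum_product]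
    refine Finset.sum_le_sum fun z _ => Finset.sum_le_sum fun s _ => ?_
    calc _ ≤ |a z s * f s z| := le_abs_self _
      _ = |a z s| * |f s z| := abs_mul _ _
      _ ≤ |a z s| * 1 := mul_le_mul_of_nonneg_left (hf _ _) (abs_nonneg _)
      _ = _ := mul_one _
  have h3 : (∑ x ∈ T ×ˢ (Finset.univ : Finset (Fin k)), |a x.1 x.2|) ^ 2 ≤
      (∑ x ∈ T ×ˢ (Finset.univ : Finset (Fin k)), r x.1) *
        ∑ x ∈ T ×ˢ (Finset.univ : Finset (Fin k)), (r x.1)⁻¹ * a x.1 x.2 ^ 2 := by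
    refine Finset.sum_sq_le_sum_mul_sum_of_sq_le_mul _ (fun x _ => hr _)
      (fun x _ => mul_nonneg (inv_nonneg.2 (hr _)) (sq_nonneg _)) (fun x _ => ?_)
    by_cases hx : r x.1 = 0
    · simp [ha, hq0 _ _ hx]
    · rw [sq_abs, mul_inv_cancel_left₀ hx]
  have h4 : ∑ x ∈ T ×ˢ (Finset.univ : Finset (Fin k)), r x.1 ≤ k := by
    rw [Finset.sum_product]
    simp only [Finset.sum_const, Finset.card_univ, Fintype.card_fin, nsmul_eq_mul,
      ← Finset.mul_sum]
    nlinarith [Nat.cast_nonneg (α := ℝ) k]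
  have h5 : ∑ x ∈ T ×ˢ (Finset.univ : Finset (Fin k)), (r x.1)⁻¹ * a x.1 x.2 ^ 2 ≤ c := by
    rw [Finset.sum_product]
    simp only [← Finset.mul_sum]
    refine hh.trans ?_
    calc ∑ z ∈ T, (r z)⁻¹ * ∑ v ∈ S, q v z ^ 2 ≤ ∑ z ∈ T, ∑ v ∈ S, q v z * c := by
          refine Finset.sum_le_sum fun z _ => ?_
          rw [Finset.mul_sum]
          refine Finset.sum_le_sum fun v _ => ?_
          by_cases hz : r z = 0
          · simp [hq0 _ _ hz]
          · have : 0 < r z := lt_of_le_of_ne (hr z) (Ne.symm hz)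
            rw [inv_mul_le_iff₀ this]
            exact hqle v z
      _ = (∑ x ∈ B, p x) * c := by
          rw [← Finset.sum_product_right (f := fun x => q x.1 x.2 * c), ← Finset.sum_mul,
            ← Finset.sum_subset hBsub]
          · congr 1
            exact Finset.sum_congr rfl fun x hx => by simp [hq, hx]
          · intro x _ hx; simp [hq, hx]
      _ ≤ 1 * c := mul_le_mul_of_nonneg_right hB hc0
      _ = c := one_mul c
  rw [h1]
  refine h2.trans (Real.le_sqrt_of_sq_le (h3.trans ?_))
  refine mul_le_mul h4 h5 (Finset.sum_nonneg fun x _ =>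
    mul_nonneg (inv_nonneg.2 (hr _)) (sq_nonneg _)) (Nat.cast_nonneg _)

/-- Leftover hashing: if the conditional probabilities given the second coordinate are at most `c`
outside a set of small probability, then some `h` makes the law of `(h v, z)` almost invariant under
translations of the first coordinate. -/
theorem exists_hash_shift {𝒱 𝒵 : Type*} [Countable 𝒱] [Countable 𝒵] [MeasurableSpace 𝒱]
    [MeasurableSpace 𝒵] [DiscreteMeasurableSpace 𝒱] [DiscreteMeasurableSpace 𝒵]
    (P : Measure (𝒱 × 𝒵)) [IsProbabilityMeasure P] {k : ℕ} [NeZero k] (B : Finset (𝒱 × 𝒵))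
    {c : ℝ} (hc0 : 0 ≤ c) (hc : ∀ x ∈ B, P.real {x} ≤ c * P.real (Prod.snd ⁻¹' {x.2})) :
    ∃ h : 𝒱 → Fin k, ∀ (t : Fin k) (E : Set (Fin k × 𝒵)),
      P.real {x | (h x.1, x.2) ∈ E} ≤ P.real {x | (h x.1 + t, x.2) ∈ E} +
        2 * (P.real (B : Set (𝒱 × 𝒵))ᶜ + √(k * c)) := by
  classical
  have hk : (k : ℝ) ≠ 0 := NeZero.ne _
  have hms : ∀ E : Set (𝒱 × 𝒵), MeasurableSet E := fun E => MeasurableSet.of_discrete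
  obtain ⟨h, hh⟩ := exists_hash_sum_abs_le (k := k) (fun x => P.real {x})
    (fun _ => measureReal_nonneg) (fun z => P.real (Prod.snd ⁻¹' {z}))
    (fun _ => measureReal_nonneg) B
    (by rw [sum_measureReal_singleton]; exact measureReal_le_one)
    (by
      rw [← measureReal_biUnion_finset (fun z _ z' _ hz => ?_) (fun _ _ => hms _)]
      · exact measureReal_le_one
      · refine Set.disjoint_left.2 fun x hx hx' => hz ?_
        exact (Set.mem_singleton_iff.1 hx).symm.trans (Set.mem_singleton_iff.1 hx'))
    hc hc0
  set δ := P.real (B : Set (𝒱 × 𝒵))ᶜ + √(k * c)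
  have hfin : ∀ E : Set (𝒱 × 𝒵), P.real (E ∩ B) =
      ∑ x ∈ B, P.real {x} * (if x ∈ E then 1 else 0) := by
    intro E
    have : E ∩ B = ((B.filter (· ∈ E) : Finset (𝒱 × 𝒵)) : Set (𝒱 × 𝒵)) := by
      ext x; simp [and_comm]
    rw [this, ← sum_measureReal_singleton, Finset.sum_filter]
    exact Finset.sum_congr rfl fun x _ => by split_ifs <;> simp
  have key : ∀ E : Set (Fin k × 𝒵), P.real {x | (h x.1, x.2) ∈ E} ≤
      1 / (k : ℝ) * ∑ s, P.real {x | (s, x.2) ∈ E} + δ := by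
    intro E
    have h1 : P.real {x | (h x.1, x.2) ∈ E} ≤
        P.real ({x | (h x.1, x.2) ∈ E} ∩ B) + P.real (B : Set (𝒱 × 𝒵))ᶜ := by
      refine (measureReal_mono ?_).trans (measureReal_union_le _ _)
      intro x hx
      by_cases hxB : x ∈ B
      · exact Or.inl ⟨hx, hxB⟩
      · exact Or.inr hxB
    have h2 : ∀ s, P.real ({x | (s, x.2) ∈ E} ∩ B) ≤ P.real {x | (s, x.2) ∈ E} :=
      fun s => measureReal_mono Set.inter_subset_left
    have h3 := hh (fun s z => if (s, z) ∈ E then 1 else 0) (fun s z => by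
      split_ifs <;> simp)
    have h4 : ∑ x ∈ B, P.real {x} * ∑ s, ((if h x.1 = s then 1 else 0) - 1 / (k : ℝ)) *
        (if (s, x.2) ∈ E then 1 else 0) = P.real ({x | (h x.1, x.2) ∈ E} ∩ B) -
        1 / (k : ℝ) * ∑ s, P.real ({x | (s, x.2) ∈ E} ∩ B) := by
      simp only [hfin, Set.mem_ofPred_eq]
      rw [Finset.sum_comm, Finset.mul_sum, ← Finset.sum_sub_distrib]
      refine Finset.sum_congr rfl fun x _ => ?_
      rw [← Finset.mul_sum]
      simp only [sub_mul, Finset.sum_sub_distrib, ← Finset.mul_sum, ite_mul, one_mul, zero_mul,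
        Finset.sum_ite_eq, Finset.mem_univ, if_true]
      ring
    have h5 : 1 / (k : ℝ) * ∑ s, P.real ({x | (s, x.2) ∈ E} ∩ B) ≤
        1 / (k : ℝ) * ∑ s, P.real {x | (s, x.2) ∈ E} :=
      mul_le_mul_of_nonneg_left (Finset.sum_le_sum fun s _ => h2 s) (by positivity)
    linarith
  have key' : ∀ E : Set (Fin k × 𝒵), 1 / (k : ℝ) * ∑ s, P.real {x | (s, x.2) ∈ E} ≤
      P.real {x | (h x.1, x.2) ∈ E} + δ := by
    intro E
    have h1 := key Eᶜ
    have h2 : P.real {x | (h x.1, x.2) ∈ Eᶜ} = 1 - P.real {x | (h x.1, x.2) ∈ E} :=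
      probReal_compl_eq_one_sub (hms _)
    have h3 : ∀ s, P.real {x | (s, x.2) ∈ Eᶜ} = 1 - P.real {x | (s, x.2) ∈ E} := fun s =>
      probReal_compl_eq_one_sub (hms _)
    simp only [h2, h3, Finset.sum_sub_distrib, Finset.sum_const, Finset.card_univ,
      Fintype.card_fin, nsmul_eq_mul, mul_one, mul_sub, one_div_mul_cancel hk] at h1
    linarith
  refine ⟨h, fun t E => ?_⟩
  have h1 := key E
  have h2 := key' {y | (y.1 + t, y.2) ∈ E}
  have h3 : ∑ s : Fin k, P.real {x | (s, x.2) ∈ {y : Fin k × 𝒵 | (y.1 + t, y.2) ∈ E}} =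
      ∑ s : Fin k, P.real {x | (s, x.2) ∈ E} :=
    Equiv.sum_comp (Equiv.addRight t) fun s : Fin k => P.real {x : 𝒱 × 𝒵 | (s, x.2) ∈ E}
  rw [h3] at h2
  simp only [Set.mem_ofPred_eq] at h2
  linarith

theorem measure_eq_tsum_inter_preimage {Ω α : Type*} [MeasurableSpace Ω]
    [DiscreteMeasurableSpace Ω] [Countable α] (P : Measure Ω) (W : Ω → α) (E : Set Ω) :
    P E = ∑' w, P (E ∩ W ⁻¹' {w}) := by
  rw [← measure_iUnion _ (fun _ => MeasurableSet.of_discrete), ← Set.inter_iUnion]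
  · congr 1; ext; simp
  · intro w w' h
    refine Set.disjoint_left.2 fun x hx hx' => h ?_
    exact (Set.mem_singleton_iff.1 hx.2).symm.trans (Set.mem_singleton_iff.1 hx'.2)

/-- If `K₁` and `K₂` are conditionally independent given `W`, then the conditionally most likely
value of `K₁` predicts `K₁` at least as well as `K₂` does. -/
theorem exists_guess {Ω α : Type*} [MeasurableSpace Ω] [DiscreteMeasurableSpace Ω] [Countable α]
    (P : Measure Ω) {k : ℕ} [NeZero k] (W : Ω → α) (K₁ K₂ : Ω → Fin k)
    (hfac : ∀ w, ∃ a b : Fin k → ℝ≥0∞, ∀ s s', P {x | W x = w ∧ K₁ x = s ∧ K₂ x = s'} =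
      a s * b s') :
    ∃ g : α → Fin k, P {x | K₁ x = K₂ x} ≤ P {x | K₁ x = g (W x)} := by
  choose a b hab using hfac
  have hmax : ∀ w, ∃ s₀, ∀ s, a w s ≤ a w s₀ := fun w => Finite.exists_max (a w)
  choose g hg using hmax
  refine ⟨g, ?_⟩
  rw [measure_eq_tsum_inter_preimage P W, measure_eq_tsum_inter_preimage P W {x | K₁ x = g (W x)}]
  refine ENNReal.tsum_le_tsum fun w => ?_
  have h1 : P ({x | K₁ x = K₂ x} ∩ W ⁻¹' {w}) = ∑ s, a w s * b w s := by
    rw [measure_eq_tsum_inter_preimage P K₁, tsum_fintype]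
    refine Finset.sum_congr rfl fun s _ => ?_
    rw [← hab]
    congr 1
    ext x
    simp only [Set.mem_inter_iff, Set.mem_ofPred_eq, Set.mem_preimage, Set.mem_singleton_iff]
    grind
  have h2 : P ({x | K₁ x = g (W x)} ∩ W ⁻¹' {w}) = ∑ s, a w (g w) * b w s := by
    rw [measure_eq_tsum_inter_preimage P K₂, tsum_fintype]
    refine Finset.sum_congr rfl fun s _ => ?_
    rw [← hab]
    congr 1
    ext x
    simp only [Set.mem_inter_iff, Set.mem_ofPred_eq, Set.mem_preimage, Set.mem_singleton_iff]
    grind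
  rw [h1, h2]
  exact Finset.sum_le_sum fun s _ => mul_le_mul_left (hg w s) _

/-! ### Conditional information density -/

theorem ae_singleton_ne_zero {α : Type*} [Countable α] [MeasurableSpace α]
    [DiscreteMeasurableSpace α] (P : Measure α) : ∀ᵐ x ∂P, P {x} ≠ 0 := by
  rw [ae_iff, measure_eq_tsum_singleton, ENNReal.tsum_eq_zero]
  rintro ⟨x, hx⟩
  simpa using hx

/-- Truncation, which covers the case of an infinite mean. -/
theorem exists_nat_lt_integral_min {Ω : Type*} [MeasurableSpace Ω] (μ : Measure Ω)
    [IsProbabilityMeasure μ] {f : Ω → ℝ} (hm : Measurable f) (hf : ∀ x, 0 ≤ f x) {r : ℝ}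
    (hr : ENNReal.ofReal r < ∫⁻ x, ENNReal.ofReal (f x) ∂μ) :
    ∃ M : ℕ, Integrable (fun x => min (f x) M) μ ∧ r < ∫ x, min (f x) (M : ℝ) ∂μ := by
  have hint : ∀ M : ℕ, Integrable (fun x => min (f x) (M : ℝ)) μ := by
    intro M
    refine Integrable.of_bound (C := M) (by fun_prop) (ae_of_all _ fun x => ?_)
    rw [Real.norm_of_nonneg (le_min (hf x) (Nat.cast_nonneg _))]
    exact min_le_right _ _
  have ht : Tendsto (fun M : ℕ => ∫⁻ x, ENNReal.ofReal (min (f x) (M : ℝ)) ∂μ) atTop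
      (𝓝 (∫⁻ x, ENNReal.ofReal (f x) ∂μ)) := by
    refine lintegral_tendsto_of_tendsto_of_monotone (fun M => by fun_prop)
      (ae_of_all _ fun x M N h => ?_) (ae_of_all _ fun x => ?_)
    · exact ENNReal.ofReal_le_ofReal (min_le_min_left _ (by exact_mod_cast h))
    · obtain ⟨N, hN⟩ := exists_nat_ge (f x)
      refine tendsto_const_nhds.congr' ?_
      filter_upwards [eventually_ge_atTop N] with M hM
      rw [min_eq_left (hN.trans (by exact_mod_cast hM))]
  obtain ⟨M, hM⟩ := (ht.eventually_const_lt hr).exists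
  refine ⟨M, hint M, ?_⟩
  rw [← ofReal_integral_eq_lintegral_ofReal (hint M)
    (ae_of_all _ fun x => le_min (hf x) (Nat.cast_nonneg _))] at hM
  exact (ENNReal.ofReal_lt_ofReal_iff'.1 hM).1

theorem tendsto_pi_sum_lt_of_lintegral {Ω : Type*} [MeasurableSpace Ω] (μ : Measure Ω)
    [IsProbabilityMeasure μ] {f : Ω → ℝ} (hm : Measurable f) (hf : ∀ x, 0 ≤ f x) {r : ℝ}
    (hr : ENNReal.ofReal r < ∫⁻ x, ENNReal.ofReal (f x) ∂μ) :
    Tendsto (fun n : ℕ => (Measure.pi fun _ : Fin n => μ) {ω | ∑ i, f (ω i) < n * r})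
      atTop (𝓝 0) := by
  obtain ⟨M, hM, hrM⟩ := exists_nat_lt_integral_min μ hm hf hr
  refine tendsto_of_tendsto_of_tendsto_of_le_of_le tendsto_const_nhds
    (tendsto_pi_sum_lt μ (by fun_prop) hM hrM) (fun _ => zero_le) fun n => measure_mono ?_
  intro ω hω
  have hω' : ∑ i, f (ω i) < n * r := hω
  exact lt_of_le_of_lt (Finset.sum_le_sum fun i _ => min_le_left _ _) hω'

theorem tendsto_pi_lt_sum_of_lintegral {Ω : Type*} [MeasurableSpace Ω] (μ : Measure Ω)
    [IsProbabilityMeasure μ] {f : Ω → ℝ} (hm : Measurable f) (hf : ∀ x, 0 ≤ f x) {r : ℝ}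
    (hr : ∫⁻ x, ENNReal.ofReal (f x) ∂μ < ENNReal.ofReal r) :
    Tendsto (fun n : ℕ => (Measure.pi fun _ : Fin n => μ) {ω | n * r < ∑ i, f (ω i)})
      atTop (𝓝 0) := by
  have hint : Integrable f μ :=
    ⟨hm.aestronglyMeasurable, by
      rw [hasFiniteIntegral_iff_ofReal (ae_of_all _ hf)]; exact hr.trans ENNReal.ofReal_lt_top⟩
  rw [← ofReal_integral_eq_lintegral_ofReal hint (ae_of_all _ hf)] at hr
  have h1 := (ENNReal.ofReal_lt_ofReal_iff'.1 hr).1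
  have h2 := tendsto_pi_sum_lt μ (g := fun x => -f x) hm.neg hint.neg (r := -r)
    (by rw [integral_neg]; linarith)
  refine h2.congr fun n => ?_
  congr 1
  ext ω
  simp only [Finset.sum_neg_distrib, Set.mem_ofPred_eq, mul_neg, neg_lt_neg_iff]

section Pair

variable {α β : Type*} [MeasurableSpace α] [MeasurableSpace β]

/-- The conditional probability of the first coordinate given the second. It is `0` where the second
coordinate has probability zero. -/
noncomputable def condProb (κ : Measure (α × β)) (x : α × β) : ℝ :=
  κ.real {x} / κ.real (Prod.snd ⁻¹' {x.2})

/-- The conditional information density, in bits, of the first coordinate given the second. It is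
`0` at points of probability zero, by the convention for the logarithm of zero. -/
noncomputable def infoDensity (κ : Measure (α × β)) (x : α × β) : ℝ :=
  -Real.logb 2 (condProb κ x)

variable (κ : Measure (α × β)) [IsProbabilityMeasure κ]

theorem condProb_nonneg (κ : Measure (α × β)) (x : α × β) : 0 ≤ condProb κ x :=
  div_nonneg measureReal_nonneg measureReal_nonneg

theorem singleton_le_snd (x : α × β) : κ.real {x} ≤ κ.real (Prod.snd ⁻¹' {x.2}) :=
  measureReal_mono (by rintro y rfl; rfl)

theorem condProb_le_one (x : α × β) : condProb κ x ≤ 1 :=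
  div_le_one_of_le₀ (singleton_le_snd κ x) measureReal_nonneg

theorem condProb_mul_snd (x : α × β) :
    condProb κ x * κ.real (Prod.snd ⁻¹' {x.2}) = κ.real {x} := by
  by_cases h : κ.real (Prod.snd ⁻¹' {x.2}) = 0
  · rw [h, mul_zero]
    exact le_antisymm measureReal_nonneg (h ▸ singleton_le_snd κ x)
  · exact div_mul_cancel₀ _ h

theorem infoDensity_nonneg (x : α × β) : 0 ≤ infoDensity κ x :=
  neg_nonneg.2 (Real.logb_nonpos one_lt_two (condProb_nonneg κ x) (condProb_le_one κ x))

theorem sum_infoDensity (κ : Measure (α × β)) {n : ℕ} {x : Fin n → α × β}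
    (h : ∀ i, condProb κ (x i) ≠ 0) :
    ∑ i, infoDensity κ (x i) = -Real.logb 2 (∏ i, condProb κ (x i)) := by
  rw [Real.logb_prod _ _ fun i _ => h i, ← Finset.sum_neg_distrib]
  rfl

theorem pi_real_singleton {n : ℕ} (x : Fin n → α × β) :
    (Measure.pi fun _ : Fin n => κ).real {x} = ∏ i, κ.real {x i} := by
  rw [measureReal_def, Measure.pi_singleton, ENNReal.toReal_prod]
  rfl

theorem pi_real_snd {n : ℕ} (z : Fin n → β) :
    (Measure.pi fun _ : Fin n => κ).real {x | (fun i => (x i).2) = z} =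
      ∏ i, κ.real (Prod.snd ⁻¹' {z i}) := by
  have : {x : Fin n → α × β | (fun i => (x i).2) = z} =
      Set.univ.pi fun i => Prod.snd ⁻¹' {z i} := by
    ext x; simp [funext_iff]
  rw [this, measureReal_def, Measure.pi_pi, ENNReal.toReal_prod]
  rfl

theorem pi_singleton_eq_prod_condProb_mul {n : ℕ} (x : Fin n → α × β) :
    (Measure.pi fun _ : Fin n => κ).real {x} = (∏ i, condProb κ (x i)) *
      (Measure.pi fun _ : Fin n => κ).real {y | (fun i => (y i).2) = fun i => (x i).2} := by
  rw [pi_real_singleton, pi_real_snd, ← Finset.prod_mul_distrib]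
  exact Finset.prod_congr rfl fun i _ => (condProb_mul_snd κ _).symm

variable [Countable α] [Countable β] [DiscreteMeasurableSpace α] [DiscreteMeasurableSpace β]

/-- Equipartition from above: below the rate of the conditional entropy, the conditional probability
of a block rarely exceeds `2 ^ (-n r)`. -/
theorem tendsto_pi_lt_prod_condProb {r : ℝ}
    (hr : ENNReal.ofReal r < ∫⁻ x, ENNReal.ofReal (infoDensity κ x) ∂κ) :
    Tendsto (fun n : ℕ => (Measure.pi fun _ : Fin n => κ)
      {x | (2 : ℝ) ^ (-(n * r)) < ∏ i, condProb κ (x i)}) atTop (𝓝 0) := by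
  refine tendsto_of_tendsto_of_tendsto_of_le_of_le tendsto_const_nhds
    (tendsto_pi_sum_lt_of_lintegral κ Measurable.of_discrete (infoDensity_nonneg κ) hr)
    (fun _ => zero_le) fun n => measure_mono ?_
  intro x hx
  simp only [Set.mem_ofPred_eq] at hx ⊢
  have hpos : 0 < ∏ i, condProb κ (x i) := (Real.rpow_pos_of_pos two_pos _).trans hx
  rw [sum_infoDensity κ fun i h => hpos.ne' (Finset.prod_eq_zero (Finset.mem_univ i) h)]
  have := (Real.lt_logb_iff_rpow_lt one_lt_two hpos).2 hx
  linarith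

/-- Equipartition from below: above the rate of the conditional entropy, the conditional probability
of a block is rarely less than `2 ^ (-n r)`. -/
theorem tendsto_pi_prod_condProb_lt {r : ℝ}
    (hr : ∫⁻ x, ENNReal.ofReal (infoDensity κ x) ∂κ < ENNReal.ofReal r) :
    Tendsto (fun n : ℕ => (Measure.pi fun _ : Fin n => κ)
      {x | ∏ i, condProb κ (x i) < (2 : ℝ) ^ (-(n * r))}) atTop (𝓝 0) := by
  refine tendsto_of_tendsto_of_tendsto_of_le_of_le tendsto_const_nhds
    (tendsto_pi_lt_sum_of_lintegral κ Measurable.of_discrete (infoDensity_nonneg κ) hr)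
    (fun _ => zero_le) fun n => measure_mono_ae ?_
  filter_upwards [ae_singleton_ne_zero (Measure.pi fun _ : Fin n => κ)] with x hx0 hx
  have hx0' : (Measure.pi fun _ : Fin n => κ).real {x} ≠ 0 :=
    (ENNReal.toReal_ne_zero.2 ⟨hx0, measure_ne_top _ _⟩)
  rw [pi_singleton_eq_prod_condProb_mul] at hx0'
  have h1 := left_ne_zero_of_mul hx0'
  have hpos : 0 < ∏ i, condProb κ (x i) :=
    lt_of_le_of_ne (Finset.prod_nonneg fun i _ => condProb_nonneg κ _) h1.symm
  change (n * r : ℝ) < ∑ i, infoDensity κ (x i)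
  rw [sum_infoDensity κ fun i h => h1 (Finset.prod_eq_zero (Finset.mem_univ i) h)]
  have := (Real.logb_lt_iff_lt_rpow one_lt_two hpos).2 hx
  linarith

/-- At most `1 / c` blocks have conditional probability at least `c`, as these probabilities add up
to at most `1`. -/
theorem card_le_of_le_prod_condProb {n : ℕ} {c : ℝ} (hc : 0 < c) (z : Fin n → β)
    (S : Finset (Fin n → α)) (hS : ∀ v ∈ S, c ≤ ∏ i, condProb κ (v i, z i)) :
    (S.card : ℝ) ≤ c⁻¹ := by
  classical
  rcases S.eq_empty_or_nonempty with rfl | ⟨v₀, hv₀⟩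
  · simpa using hc.le
  set P := Measure.pi fun _ : Fin n => κ
  have hinj : Function.Injective fun (v : Fin n → α) (i : Fin n) => (v i, z i) := by
    intro v v' h
    funext i
    exact congrArg Prod.fst (congrFun h i)
  have hsub : ∑ v ∈ S, P.real {fun i => (v i, z i)} ≤ P.real {x | (fun i => (x i).2) = z} := by
    rw [← Finset.sum_image (f := fun x => P.real {x}) fun v _ v' _ h => hinj h,
      sum_measureReal_singleton]
    refine measureReal_mono fun x hx => ?_
    obtain ⟨v, _, rfl⟩ := Finset.mem_image.1 (Finset.mem_coe.1 hx)
    rfl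
  have h1 : ∀ v : Fin n → α, P.real {fun i => (v i, z i)} = (∏ i, condProb κ (v i, z i)) *
      P.real {x | (fun i => (x i).2) = z} := fun v => pi_singleton_eq_prod_condProb_mul κ _
  simp only [h1, ← Finset.sum_mul] at hsub
  have hz : 0 < P.real {x | (fun i => (x i).2) = z} := by
    rw [pi_real_snd]
    refine Finset.prod_pos fun i _ => lt_of_le_of_ne measureReal_nonneg fun h => ?_
    have h2 := hS v₀ hv₀
    rw [Finset.prod_eq_zero (Finset.mem_univ i) (by simp [condProb, ← h])] at h2
    exact absurd h2 (not_le.2 hc)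
  have h3 : ∑ v ∈ S, ∏ i : Fin n, condProb κ (v i, z i) ≤ 1 := by
    by_contra h
    nlinarith
  have h4 : (S.card : ℝ) * c ≤ 1 := by
    rw [← nsmul_eq_mul]
    exact (Finset.card_nsmul_le_sum S _ c hS).trans h3
  rwa [← one_div, le_div_iff₀ hc]

/-- Privacy amplification: at every rate `R` below the conditional entropy of the first coordinate
given the second, hashing the first coordinates of a block leaves a key whose joint law with the
second coordinates is asymptotically invariant under translations of the key. The error `δ` does not
depend on the key size. -/
theorem exists_tendsto_hash {R r : ℝ} (hRr : R < r)
    (hr : ENNReal.ofReal r < ∫⁻ x, ENNReal.ofReal (infoDensity κ x) ∂κ) :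
    ∃ δ : ℕ → ℝ, (∀ n, 0 ≤ δ n) ∧ Tendsto δ atTop (𝓝 0) ∧ ∀ (n k : ℕ) [NeZero k],
      (k : ℝ) ≤ 2 ^ (n * R) → ∃ h : (Fin n → α) → Fin k,
        ∀ (t : Fin k) (E : Set (Fin k × (Fin n → β))),
        (Measure.pi fun _ : Fin n => κ).real
            {x | (h fun i => (x i).1, fun i => (x i).2) ∈ E} ≤
          (Measure.pi fun _ : Fin n => κ).real
            {x | ((h fun i => (x i).1) + t, fun i => (x i).2) ∈ E} + δ n := by
  classical
  set P : ∀ n : ℕ, Measure (Fin n → α × β) := fun n => Measure.pi fun _ : Fin n => κ with hP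
  set bad : ∀ n : ℕ, Set (Fin n → α × β) :=
    fun n => {x | (2 : ℝ) ^ (-(n * r)) < ∏ i, condProb κ (x i)} with hbad
  refine ⟨fun n => 2 * (((P n).real (bad n) + 1 / ((n : ℝ) + 1)) + √((2 ^ (R - r)) ^ n)),
    fun n => by positivity, ?_, ?_⟩
  · have h1 : Tendsto (fun n => (P n).real (bad n)) atTop (𝓝 0) := by
      have := (ENNReal.tendsto_toReal ENNReal.zero_ne_top).comp (tendsto_pi_lt_prod_condProb κ hr)
      exact this
    have h2 := tendsto_one_div_add_atTop_nhds_zero_nat (𝕜 := ℝ)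
    have h3 : Tendsto (fun n : ℕ => √(((2 : ℝ) ^ (R - r)) ^ n)) atTop (𝓝 0) := by
      have := tendsto_pow_atTop_nhds_zero_of_lt_one
        (Real.rpow_nonneg zero_le_two (R - r))
        (Real.rpow_lt_one_of_one_lt_of_neg one_lt_two (sub_neg.2 hRr))
      simpa using this.sqrt
    simpa using ((h1.add h2).add h3).const_mul 2
  intro n k _ hk
  set φ : (Fin n → α × β) → (Fin n → α) × (Fin n → β) :=
    fun x => (fun i => (x i).1, fun i => (x i).2) with hφ
  have hφm : Measurable φ := Measurable.of_discrete
  have hφi : Function.Injective φ := by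
    intro x y h
    funext i
    exact Prod.ext (congrFun (congrArg Prod.fst h) i) (congrFun (congrArg Prod.snd h) i)
  set Q := (P n).map φ with hQ
  have : IsProbabilityMeasure Q := Measure.isProbabilityMeasure_map hφm.aemeasurable
  have hQr : ∀ E, Q.real E = (P n).real (φ ⁻¹' E) := fun E =>
    map_measureReal_apply hφm MeasurableSet.of_discrete
  obtain ⟨s, hs⟩ := exists_finset_measure_compl_le (P n) (ε := ENNReal.ofReal (1 / ((n : ℝ) + 1)))
    (by rw [Ne, ENNReal.ofReal_eq_zero, not_le]; positivity)
  have hs' : (P n).real (s : Set _)ᶜ ≤ 1 / ((n : ℝ) + 1) :=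
    ENNReal.toReal_le_of_le_ofReal (by positivity) hs
  -- The hashing lemma needs a finite set of good blocks; `s` misses mass at most
  -- `1 / (n + 1)`.
  set B : Finset ((Fin n → α) × (Fin n → β)) := (s.filter (· ∉ bad n)).image φ with hB
  obtain ⟨h, hh⟩ := exists_hash_shift Q (k := k) B (c := 2 ^ (-(n * r)))
    (Real.rpow_nonneg zero_le_two _) (by
      intro y hy
      obtain ⟨x, hx, rfl⟩ := Finset.mem_image.1 hy
      have hx := (Finset.mem_filter.1 hx).2
      rw [hQr, hQr]
      have e1 : φ ⁻¹' {φ x} = {x} := by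
        ext y; simp [hφi.eq_iff]
      rw [e1, hP]
      simp only
      rw [pi_singleton_eq_prod_condProb_mul]
      exact mul_le_mul_of_nonneg_right (not_lt.1 hx) measureReal_nonneg)
  refine ⟨h, fun t E => ?_⟩
  have h1 := hh t E
  rw [hQr, hQr, hQr] at h1
  have h2 : (P n).real (φ ⁻¹' (B : Set _)ᶜ) ≤ (P n).real (bad n) + 1 / ((n : ℝ) + 1) := by
    refine (measureReal_mono ?_).trans ((measureReal_union_le (bad n) (s : Set _)ᶜ).trans
      (by gcongr))
    intro x hx
    by_contra hcon
    simp only [Set.mem_union, not_or, Set.mem_compl_iff, not_not] at hcon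
    exact hx (Finset.mem_coe.2 (Finset.mem_image_of_mem _ (Finset.mem_filter.2 ⟨hcon.2, hcon.1⟩)))
  have h3 : √(k * (2 : ℝ) ^ (-(n * r))) ≤ √((2 ^ (R - r)) ^ n) := by
    refine Real.sqrt_le_sqrt ?_
    calc (k : ℝ) * (2 : ℝ) ^ (-(n * r)) ≤ 2 ^ (n * R) * 2 ^ (-(n * r)) := by gcongr
      _ = _ := by
        rw [← Real.rpow_add two_pos, ← Real.rpow_natCast, ← Real.rpow_mul zero_le_two]
        congr 1; ring
  refine h1.trans (add_le_add le_rfl ?_)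
  change _ ≤ 2 * _
  gcongr

end Pair

theorem condEntropy_eq_lintegral {Ω α β : Type*} [MeasurableSpace Ω] (μ : Measure Ω)
    [IsProbabilityMeasure μ] [Countable α] [Countable β] [MeasurableSpace α] [MeasurableSpace β]
    [DiscreteMeasurableSpace α] [DiscreteMeasurableSpace β] {U : Ω → α} {W : Ω → β}
    (hU : Measurable U) (hW : Measurable W) :
    condEntropy μ U W = ∫⁻ x, ENNReal.ofReal
      (infoDensity (μ.map fun ω => (U ω, W ω)) x) ∂(μ.map fun ω => (U ω, W ω)) := by
  set κ := μ.map fun ω => (U ω, W ω) with hκ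
  have hUW : Measurable fun ω => (U ω, W ω) := hU.prodMk hW
  have : IsProbabilityMeasure κ := Measure.isProbabilityMeasure_map hUW.aemeasurable
  rw [lintegral_countable', ENNReal.tsum_prod', ENNReal.tsum_comm]
  refine tsum_congr fun w => ?_
  rw [entropy, ← ENNReal.tsum_mul_left]
  refine tsum_congr fun u => ?_
  have h1 : κ {(u, w)} = μ ({ω | W ω = w} ∩ {ω | U ω = u}) := by
    rw [hκ, Measure.map_apply hUW (measurableSet_singleton _)]
    congr 1; ext ω; simp [and_comm]
  have h2 : κ (Prod.snd ⁻¹' {w}) = μ {ω | W ω = w} := by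
    rw [hκ, Measure.map_apply hUW MeasurableSet.of_discrete]; rfl
  have h3 : (ProbabilityTheory.cond μ {ω | W ω = w}).real {ω | U ω = u} = condProb κ (u, w) := by
    rw [measureReal_def, cond_apply (s := {ω | W ω = w}) (hW (measurableSet_singleton w)), condProb,
      measureReal_def κ, measureReal_def κ, h1, h2, div_eq_inv_mul, ENNReal.toReal_mul,
      ENNReal.toReal_inv]
  rw [h3, ← h2]
  have h4 : Real.negMulLog (condProb κ (u, w)) / Real.log 2 =
      condProb κ (u, w) * infoDensity κ (u, w) := by
    rw [Real.negMulLog, infoDensity, Real.logb]; ring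
  rw [h4, ENNReal.ofReal_mul (condProb_nonneg _ _), ← mul_assoc, mul_comm]
  congr 1
  rw [← ofReal_measureReal (μ := κ) (s := {(u, w)}), ← condProb_mul_snd κ (u, w),
    ENNReal.ofReal_mul (condProb_nonneg _ _), ofReal_measureReal, mul_comm]

/-! ### Secrecy as closeness to the ideal law -/

section KeyLaw

/-- The joint law of a uniform key in `Fin k` and an independent copy of `Y`. -/
noncomputable def idealLaw {D β : Type*} [MeasurableSpace D] [MeasurableSpace β] (P : Measure D)
    (k : ℕ) (Y : D → β) : Measure (Fin k × β) :=
  ((k : ℝ≥0∞)⁻¹ • Measure.count : Measure (Fin k)).prod (P.map Y)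

theorem isProbabilityMeasure_uniform {k : ℕ} [NeZero k] :
    IsProbabilityMeasure ((k : ℝ≥0∞)⁻¹ • Measure.count : Measure (Fin k)) := by
  constructor
  rw [Measure.smul_apply, Measure.count_univ, smul_eq_mul]
  simp only [ENat.card_eq_coe_fintype_card, Fintype.card_fin, ENat.toENNReal_coe]
  exact ENNReal.inv_mul_cancel (by exact_mod_cast NeZero.ne k) (ENNReal.natCast_ne_top k)

variable {D β : Type*} [MeasurableSpace D] [DiscreteMeasurableSpace D] [MeasurableSpace β]
  (P : Measure D) [IsProbabilityMeasure P] {k : ℕ} (Y : D → β)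

theorem isProbabilityMeasure_idealLaw [NeZero k] : IsProbabilityMeasure (idealLaw P k Y) := by
  have := isProbabilityMeasure_uniform (k := k)
  have := Measure.isProbabilityMeasure_map (μ := P) (f := Y) Measurable.of_discrete.aemeasurable
  unfold idealLaw
  infer_instance

variable [DiscreteMeasurableSpace β]

theorem idealLaw_real_singleton (w : Fin k × β) :
    (idealLaw P k Y).real {w} = 1 / (k : ℝ) * P.real {d | Y d = w.2} := by
  have := Measure.isProbabilityMeasure_map (μ := P) (f := Y) Measurable.of_discrete.aemeasurable
  obtain ⟨s, y⟩ := w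
  rw [idealLaw, ← Set.singleton_prod_singleton, measureReal_def, Measure.prod_prod,
    ENNReal.toReal_mul, Measure.smul_apply, Measure.count_singleton,
    Measure.map_apply Measurable.of_discrete MeasurableSet.of_discrete]
  simp only [smul_eq_mul, mul_one, ENNReal.toReal_inv, ENNReal.toReal_natCast, one_div]
  rfl

variable [Countable β]

theorem idealLaw_apply (E : Set (Fin k × β)) :
    idealLaw P k Y E = (k : ℝ≥0∞)⁻¹ * ∑ s, P {d | (s, Y d) ∈ E} := by
  have := Measure.isProbabilityMeasure_map (μ := P) (f := Y) Measurable.of_discrete.aemeasurable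
  rw [idealLaw, Measure.prod_apply MeasurableSet.of_discrete, lintegral_smul_measure,
    lintegral_count, tsum_fintype, smul_eq_mul]
  congr 1
  refine Finset.sum_congr rfl fun s _ => ?_
  rw [Measure.map_apply Measurable.of_discrete MeasurableSet.of_discrete]
  rfl

theorem statDist_key_eq (K : D → Fin k) :
    statDist (fun w : Fin k × β => P.real {d | K d = w.1 ∧ Y d = w.2})
      (fun w => 1 / (k : ℝ) * P.real {d | Y d = w.2}) =
    (∑' w, ENNReal.ofReal |(P.map fun d => (K d, Y d)).real {w} - (idealLaw P k Y).real {w}|) / 2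
      := by
  rw [statDist]
  congr 1
  refine tsum_congr fun w => ?_
  rw [idealLaw_real_singleton, map_measureReal_apply Measurable.of_discrete
    MeasurableSet.of_discrete]
  have : (fun d => (K d, Y d)) ⁻¹' {w} = {d | K d = w.1 ∧ Y d = w.2} := by
    ext d; simp [Prod.ext_iff]
  rw [this]

variable [NeZero k]

theorem idealLaw_le_of_card_le (E : Set (Fin k × β)) {N : ℝ}
    (hE : ∀ (y : β) (S : Finset (Fin k)), (∀ s ∈ S, (s, y) ∈ E) → (S.card : ℝ) ≤ N) :
    idealLaw P k Y E ≤ ENNReal.ofReal (N / k) := by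
  classical
  have := isProbabilityMeasure_uniform (k := k)
  have := Measure.isProbabilityMeasure_map (μ := P) (f := Y) Measurable.of_discrete.aemeasurable
  have hk : (0 : ℝ) < k := by exact_mod_cast Nat.pos_of_ne_zero (NeZero.ne k)
  rw [idealLaw, Measure.prod_apply_symm MeasurableSet.of_discrete]
  calc _ ≤ ∫⁻ _, ENNReal.ofReal (N / k) ∂(P.map Y) := by
        refine lintegral_mono fun y => ?_
        have h1 : ((fun s : Fin k => (s, y)) ⁻¹' E) =
            ((Finset.univ.filter fun s : Fin k => (s, y) ∈ E : Finset (Fin k)) : Set (Fin k)) := by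
          ext; simp
        have h2 := hE y (Finset.univ.filter fun s : Fin k => (s, y) ∈ E)
          (fun s hs => (Finset.mem_filter.1 hs).2)
        rw [h1, Measure.smul_apply, Measure.count_apply_finset, smul_eq_mul,
          ENNReal.ofReal_div_of_pos hk, ENNReal.ofReal_natCast, mul_comm, div_eq_mul_inv]
        gcongr
        rw [← ENNReal.ofReal_natCast]
        exact ENNReal.ofReal_le_ofReal h2
    _ = _ := by simp

/-- A secret key rarely lies in a small set that the eavesdropper can compute from `Y`. -/
theorem measure_key_le (K : D → Fin k) {σ : ℝ} (hσ : 0 ≤ σ)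
    (h : statDist (fun w : Fin k × β => P.real {d | K d = w.1 ∧ Y d = w.2})
      (fun w => 1 / (k : ℝ) * P.real {d | Y d = w.2}) ≤ ENNReal.ofReal σ)
    (E : Set (Fin k × β)) {N : ℝ} (hN : 0 ≤ N)
    (hE : ∀ (y : β) (S : Finset (Fin k)), (∀ s ∈ S, (s, y) ∈ E) → (S.card : ℝ) ≤ N) :
    P.real {d | (K d, Y d) ∈ E} ≤ N / k + 2 * σ := by
  have := isProbabilityMeasure_idealLaw P (k := k) Y
  have := Measure.isProbabilityMeasure_map (μ := P) (f := fun d => (K d, Y d))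
    Measurable.of_discrete.aemeasurable
  rw [statDist_key_eq, ENNReal.div_le_iff (by simp) (by simp)] at h
  have h1 := measure_le_add_tsum (P.map fun d => (K d, Y d)) (idealLaw P k Y) E
  rw [Measure.map_apply Measurable.of_discrete MeasurableSet.of_discrete] at h1
  have h2 : P {d | (K d, Y d) ∈ E} ≤ ENNReal.ofReal (N / k + 2 * σ) := by
    rw [ENNReal.ofReal_add (by positivity) (by positivity), mul_comm 2 σ,
      ENNReal.ofReal_mul hσ, ENNReal.ofReal_ofNat]
    exact h1.trans (add_le_add (idealLaw_le_of_card_le P Y E hE) h)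
  exact ENNReal.toReal_le_of_le_ofReal (by positivity) h2

/-- A key whose joint law with `Y` is almost invariant under translations of the key is almost
ideal: the ideal law is the average of the translates. -/
theorem statDist_key_le_of_shift (K : D → Fin k) {δ : ℝ≥0∞}
    (h : ∀ (t : Fin k) (E : Set (Fin k × β)),
      P {d | (K d, Y d) ∈ E} ≤ P {d | (K d + t, Y d) ∈ E} + δ) :
    statDist (fun w : Fin k × β => P.real {d | K d = w.1 ∧ Y d = w.2})
      (fun w => 1 / (k : ℝ) * P.real {d | Y d = w.2}) ≤ δ := by
  have := isProbabilityMeasure_idealLaw P (k := k) Y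
  have := Measure.isProbabilityMeasure_map (μ := P) (f := fun d => (K d, Y d))
    Measurable.of_discrete.aemeasurable
  have hk0 : (k : ℝ≥0∞) ≠ 0 := by exact_mod_cast NeZero.ne k
  have hkt : (k : ℝ≥0∞) ≠ ∞ := ENNReal.natCast_ne_top k
  have havg : ∀ c : ℝ≥0∞, (k : ℝ≥0∞)⁻¹ * ∑ _t : Fin k, c = c := by
    intro c
    rw [Finset.sum_const, Finset.card_univ, Fintype.card_fin, nsmul_eq_mul, ← mul_assoc,
      ENNReal.inv_mul_cancel hk0 hkt, one_mul]
  have hQ : ∀ E : Set (Fin k × β), idealLaw P k Y E =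
      (k : ℝ≥0∞)⁻¹ * ∑ t, P {d | (K d + t, Y d) ∈ E} := by
    intro E
    rw [idealLaw_apply]
    congr 1
    have e1 : ∀ f : D → Fin k → Fin k, ∑ t, P {d | (f d t, Y d) ∈ E} =
        ∫⁻ d, ∑ t, {d | (f d t, Y d) ∈ E}.indicator 1 d ∂P := by
      intro f
      rw [lintegral_finsetSum _ fun _ _ => Measurable.of_discrete]
      exact Finset.sum_congr rfl fun t _ => (lintegral_indicator_one MeasurableSet.of_discrete).symm
    rw [e1 fun _ t => t, e1 fun d t => K d + t]
    refine lintegral_congr fun d => ?_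
    exact (Equiv.sum_comp (Equiv.addLeft (K d))
      fun t => {d | (t, Y d) ∈ E}.indicator (1 : D → ℝ≥0∞) d).symm
  rw [statDist_key_eq, ENNReal.div_le_iff (by simp) (by simp), mul_comm]
  refine tsum_ofReal_abs_sub_le _ _ (fun E => ?_) (fun E => ?_)
  · rw [Measure.map_apply Measurable.of_discrete MeasurableSet.of_discrete, hQ]
    calc _ = (k : ℝ≥0∞)⁻¹ * ∑ _t : Fin k, P {d | (K d, Y d) ∈ E} := (havg _).symm
      _ ≤ (k : ℝ≥0∞)⁻¹ * ∑ t : Fin k, (P {d | (K d + t, Y d) ∈ E} + δ) := by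
        gcongr with t; exact h t E
      _ = _ := by rw [Finset.sum_add_distrib, mul_add, havg]
  · rw [Measure.map_apply Measurable.of_discrete MeasurableSet.of_discrete, hQ]
    calc _ ≤ (k : ℝ≥0∞)⁻¹ * ∑ _t : Fin k, (P {d | (K d, Y d) ∈ E} + δ) := by
          gcongr with t
          have := h (-t) {y | (y.1 + t, y.2) ∈ E}
          simpa using this
      _ = _ := havg _

end KeyLaw

/-! ### The canonical model of the source -/

section Model

theorem measure_ext_of_singleton {α : Type*} [Countable α] [MeasurableSpace α]
    [DiscreteMeasurableSpace α] {P Q : Measure α} (h : ∀ x, P {x} = Q {x}) : P = Q := by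
  ext B _
  rw [measure_eq_tsum_singleton, measure_eq_tsum_singleton]
  simp_rw [h]

/-- The joint law of the variable of an edge and of the wiretapper's observation of it. -/
noncomputable def edgeLaw {ι : Type*} {Ω : Type*} [MeasurableSpace Ω] (μ : Measure Ω)
    {𝒱 𝒵 : ι → Type*} [∀ e, MeasurableSpace (𝒱 e)] [∀ e, MeasurableSpace (𝒵 e)]
    (V : (e : ι) → Ω → 𝒱 e) (Z : (e : ι) → Ω → 𝒵 e) (e : ι) : Measure (𝒱 e × 𝒵 e) :=
  μ.map fun ω => (V e ω, Z e ω)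

variable {ι : Type*} {Ω : Type*} [MeasurableSpace Ω] (μ : Measure Ω)
  [IsProbabilityMeasure μ] {𝒱 𝒵 : ι → Type*}
  [∀ e, MeasurableSpace (𝒱 e)] [∀ e, MeasurableSpace (𝒵 e)]
  {V : (e : ι) → Ω → 𝒱 e} {Z : (e : ι) → Ω → 𝒵 e}

theorem isProbabilityMeasure_edgeLaw (hV : ∀ e, Measurable (V e)) (hZ : ∀ e, Measurable (Z e))
    (e : ι) : IsProbabilityMeasure (edgeLaw μ V Z e) :=
  Measure.isProbabilityMeasure_map ((hV e).prodMk (hZ e)).aemeasurable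

variable [Fintype ι] [∀ e, MeasurableSingletonClass (𝒱 e)] [∀ e, MeasurableSingletonClass (𝒵 e)]

/-- The pairs `(V e, Z e)` are mutually independent. -/
theorem measure_pairs_eq_prod (hV : ∀ e, Measurable (V e)) (hZ : ∀ e, Measurable (Z e))
    (hind : iIndepFun V μ)
    (hfac : ∀ (v : (e : ι) → 𝒱 e) (z : (e : ι) → 𝒵 e), μ {ω | ∀ e, V e ω = v e} ≠ 0 →
      ProbabilityTheory.cond μ {ω | ∀ e, V e ω = v e} {ω | ∀ e, Z e ω = z e} =
        ∏ e, ProbabilityTheory.cond μ {ω | V e ω = v e} {ω | Z e ω = z e})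
    (x : ∀ e, 𝒱 e × 𝒵 e) :
    μ {ω | ∀ e, (V e ω, Z e ω) = x e} = ∏ e, edgeLaw μ V Z e {x e} := by
  have hm : ∀ e, MeasurableSet {ω | V e ω = (x e).1} := fun e => hV e (measurableSet_singleton _)
  have hm' : MeasurableSet {ω | ∀ e, V e ω = (x e).1} := by
    rw [Set.ofPred_forall]; exact MeasurableSet.iInter hm
  have h1 : μ {ω | ∀ e, V e ω = (x e).1} = ∏ e, μ {ω | V e ω = (x e).1} := by
    have := hind.measure_inter_preimage_eq_mul Finset.univ
      (sets := fun e => {(x e).1}) fun e _ => measurableSet_singleton _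
    simp only [Finset.mem_univ, Set.iInter_true] at this
    rw [Set.ofPred_forall]
    exact this
  have h2 : ∀ e, edgeLaw μ V Z e {x e} = μ ({ω | V e ω = (x e).1} ∩ {ω | Z e ω = (x e).2}) := by
    intro e
    rw [edgeLaw, Measure.map_apply ((hV e).prodMk (hZ e)) (measurableSet_singleton _)]
    congr 1; ext ω; simp [Prod.ext_iff]
  have h3 : {ω | ∀ e, (V e ω, Z e ω) = x e} =
      {ω | ∀ e, V e ω = (x e).1} ∩ {ω | ∀ e, Z e ω = (x e).2} := by
    ext ω; simp [Prod.ext_iff, forall_and]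
  simp only [h2, h3]
  by_cases h0 : μ {ω | ∀ e, V e ω = (x e).1} = 0
  · rw [measure_mono_null Set.inter_subset_left h0]
    rw [h1, Finset.prod_eq_zero_iff] at h0
    obtain ⟨e, he, h0⟩ := h0
    exact (Finset.prod_eq_zero he (measure_mono_null Set.inter_subset_left h0)).symm
  · rw [← cond_mul_eq_inter hm' , hfac _ _ h0, h1, ← Finset.prod_mul_distrib]
    exact Finset.prod_congr rfl fun e _ => cond_mul_eq_inter (hm e) _ _

variable [∀ e, Countable (𝒱 e)] [∀ e, Countable (𝒵 e)]

theorem map_pairs_eq_pi (hV : ∀ e, Measurable (V e)) (hZ : ∀ e, Measurable (Z e))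
    (hpair : ∀ x : ∀ e, 𝒱 e × 𝒵 e,
      μ {ω | ∀ e, (V e ω, Z e ω) = x e} = ∏ e, edgeLaw μ V Z e {x e}) :
    μ.map (fun ω e => (V e ω, Z e ω)) = Measure.pi (edgeLaw μ V Z) := by
  have := fun e => isProbabilityMeasure_edgeLaw μ hV hZ e
  refine measure_ext_of_singleton fun x => ?_
  rw [Measure.map_apply (measurable_pi_lambda _ fun e => (hV e).prodMk (hZ e))
    (measurableSet_singleton _), Measure.pi_singleton, ← hpair]
  congr 1; ext ω; simp [funext_iff]

theorem map_blocks_eq_pi (hV : ∀ e, Measurable (V e)) (hZ : ∀ e, Measurable (Z e))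
    (hpair : ∀ x : ∀ e, 𝒱 e × 𝒵 e,
      μ {ω | ∀ e, (V e ω, Z e ω) = x e} = ∏ e, edgeLaw μ V Z e {x e}) (n : ℕ) :
    (Measure.pi fun _ : Fin n => μ).map (fun ω e i => (V e (ω i), Z e (ω i))) =
      Measure.pi fun e => Measure.pi fun _ : Fin n => edgeLaw μ V Z e := by
  have := fun e => isProbabilityMeasure_edgeLaw μ hV hZ e
  refine measure_ext_of_singleton fun x => ?_
  rw [Measure.map_apply (by fun_prop) (measurableSet_singleton _), Measure.pi_singleton]
  simp_rw [Measure.pi_singleton]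
  rw [Finset.prod_comm]
  simp_rw [← hpair fun e => x e _]
  rw [← Measure.pi_pi]
  congr 1; ext ω
  simp only [Set.mem_preimage, Set.mem_singleton_iff, Set.mem_pi, Set.mem_univ, true_implies,
    Set.mem_ofPred_eq, funext_iff]
  exact forall_comm

/-- Given `Z`, only the component `Z e` is informative about `V e`: the other factors cancel in the
conditional probability. -/
theorem condEntropy_edge (hV : ∀ e, Measurable (V e)) (hZ : ∀ e, Measurable (Z e))
    (hpair : ∀ x : ∀ e, 𝒱 e × 𝒵 e,
      μ {ω | ∀ e, (V e ω, Z e ω) = x e} = ∏ e, edgeLaw μ V Z e {x e}) (e : ι) :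
    condEntropy μ (V e) (fun ω e' => Z e' ω) =
      ∫⁻ x, ENNReal.ofReal (infoDensity (edgeLaw μ V Z e) x) ∂edgeLaw μ V Z e := by
  classical
  have := fun e => isProbabilityMeasure_edgeLaw μ hV hZ e
  have hpm : Measurable fun ω e => (V e ω, Z e ω) :=
    measurable_pi_lambda _ fun e => (hV e).prodMk (hZ e)
  have hZm : Measurable fun ω e' => Z e' ω := measurable_pi_lambda _ hZ
  have hVZ : Measurable fun ω => (V e ω, fun e' => Z e' ω) := (hV e).prodMk hZm
  have hVZe : Measurable fun ω => (V e ω, Z e ω) := (hV e).prodMk (hZ e)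
  rw [condEntropy_eq_lintegral μ (hV e) hZm, lintegral_map Measurable.of_discrete hVZ]
  conv_rhs => rw [edgeLaw, lintegral_map Measurable.of_discrete hVZe]
  set κ := μ.map fun ω => (V e ω, fun e' => Z e' ω) with hκ
  have : IsProbabilityMeasure κ := Measure.isProbabilityMeasure_map hVZ.aemeasurable
  have hae : ∀ᵐ ω ∂μ, κ {(V e ω, fun e' => Z e' ω)} ≠ 0 :=
    ae_of_ae_map hVZ.aemeasurable (ae_singleton_ne_zero κ)
  refine lintegral_congr_ae ?_
  filter_upwards [hae] with ω hω
  congr 1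
  change infoDensity κ _ = infoDensity (edgeLaw μ V Z e) _
  rw [infoDensity, infoDensity]
  congr 2
  set z : ∀ e', 𝒵 e' := fun e' => Z e' ω
  set c : ℝ≥0∞ := ∏ e' ∈ Finset.univ.erase e, edgeLaw μ V Z e' (Prod.snd ⁻¹' {z e'})
  have hbox : ∀ B : Set (𝒱 e × 𝒵 e), μ {ω' | (V e ω', Z e ω') ∈ B ∧
      ∀ e' ≠ e, Z e' ω' = z e'} = edgeLaw μ V Z e B * c := by
    intro B
    have h1 : {ω' | (V e ω', Z e ω') ∈ B ∧ ∀ e' ≠ e, Z e' ω' = z e'} =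
        (fun ω e => (V e ω, Z e ω)) ⁻¹' (Set.univ.pi
          (Function.update (fun e' => Prod.snd ⁻¹' {z e'}) e B)) := by
      ext ω'
      simp only [Set.mem_ofPred_eq, Set.mem_preimage, Set.mem_pi, Set.mem_univ, true_implies]
      constructor
      · rintro ⟨h, h'⟩ e'
        by_cases he : e' = e
        · subst he; simpa using h
        · simpa [he] using h' e' he
      · intro h
        refine ⟨by simpa using h e, fun e' he => ?_⟩
        simpa [he] using h e'
    rw [h1, ← Measure.map_apply hpm MeasurableSet.of_discrete, map_pairs_eq_pi μ hV hZ hpair,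
      Measure.pi_pi, ← Finset.mul_prod_erase _ _ (Finset.mem_univ e), Function.update_self]
    congr 1
    exact Finset.prod_congr rfl fun e' he' => by
      rw [Function.update_of_ne (Finset.ne_of_mem_erase he')]
  have h1 : κ {(V e ω, z)} = edgeLaw μ V Z e {(V e ω, z e)} * c := by
    rw [hκ, Measure.map_apply hVZ (measurableSet_singleton _), ← hbox]
    congr 1; ext ω'
    simp only [Set.mem_preimage, Set.mem_singleton_iff, Prod.mk.injEq, funext_iff,
      Set.mem_ofPred_eq]
    constructor
    · rintro ⟨h, h'⟩; exact ⟨⟨h, h' e⟩, fun e' _ => h' e'⟩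
    · rintro ⟨⟨h, h'⟩, h''⟩
      refine ⟨h, fun e' => ?_⟩
      by_cases he : e' = e
      · subst he; exact h'
      · exact h'' e' he
  have h2 : κ (Prod.snd ⁻¹' {z}) = edgeLaw μ V Z e (Prod.snd ⁻¹' {z e}) * c := by
    rw [hκ, Measure.map_apply hVZ MeasurableSet.of_discrete, ← hbox]
    congr 1; ext ω'
    simp only [Set.mem_preimage, Set.mem_singleton_iff, funext_iff, Set.mem_ofPred_eq]
    constructor
    · intro h'; exact ⟨h' e, fun e' _ => h' e'⟩
    · rintro ⟨h', h''⟩ e'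
      by_cases he : e' = e
      · subst he; exact h'
      · exact h'' e' he
  have hc0 : c ≠ 0 := by
    intro h0
    rw [h1, h0, mul_zero] at hω
    exact hω rfl
  have hct : c ≠ ∞ := ENNReal.prod_ne_top fun e' _ => measure_ne_top _ _
  have hc : c.toReal ≠ 0 := ENNReal.toReal_ne_zero.2 ⟨hc0, hct⟩
  rw [condProb, condProb, measureReal_def, measureReal_def, h1, h2, ENNReal.toReal_mul,
    ENNReal.toReal_mul, mul_div_mul_right _ _ hc]
  rfl

end Model

/-! ### Separation by an edge of the smallest subtree -/

section Graph

variable {m : ℕ} {G : SimpleGraph (Fin m)} {A : Finset (Fin m)} {T : G.Subgraph}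

/-- Otherwise the component of `a` in `T` without the edge would be a smaller subtree containing
`A`. -/
theorem exists_mem_not_reachable (hG : G.IsTree) (hT : IsSmallestSubtree G A T) {a b : Fin m}
    (hab : T.Adj a b) :
    ∃ j ∈ A, ¬ (T.spanningCoe.deleteEdges {s(a, b)}).Reachable a j := by
  by_contra! hall
  set H := T.spanningCoe.deleteEdges {s(a, b)} with hH
  have hHT : ∀ {u v}, H.Adj u v → T.Adj u v := fun h => (SimpleGraph.deleteEdges_adj.1 h).1
  have hHG : H ≤ G.deleteEdges {s(a, b)} := by
    intro u v h
    rw [SimpleGraph.deleteEdges_adj] at h ⊢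
    exact ⟨T.adj_sub h.1, h.2⟩
  have hb : ¬ H.Reachable a b := by
    have := (SimpleGraph.isAcyclic_iff_forall_isBridge.1 hG.isAcyclic)
      (e := s(a, b)) (T.adj_sub hab)
    rw [SimpleGraph.isBridge_iff] at this
    exact fun h => this (h.mono hHG)
  let T' : G.Subgraph :=
    { verts := {u | H.Reachable a u}
      Adj := fun u v => H.Adj u v ∧ H.Reachable a u
      adj_sub := fun h => T.adj_sub (hHT h.1)
      edge_vert := fun h => h.2
      symm := ⟨fun u v h => ⟨h.1.symm, h.2.trans h.1.reachable⟩⟩ }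
  have hconn : ∀ u (hu : H.Reachable a u),
      T'.coe.Reachable ⟨a, SimpleGraph.Reachable.refl a⟩ ⟨u, hu⟩ := by
    intro u hu
    have hu' := (SimpleGraph.reachable_iff_reflTransGen _ _).1 hu
    induction hu' with
    | refl => exact SimpleGraph.Reachable.refl _
    | tail h1 h2 ih =>
      rename_i v w
      have hv : H.Reachable a v := (SimpleGraph.reachable_iff_reflTransGen _ _).2 h1
      refine (ih hv).trans (SimpleGraph.Adj.reachable ?_)
      exact ⟨h2, hv⟩
  have hT' : T'.coe.IsTree := by
    refine ⟨?_, hG.isAcyclic.subgraph T'⟩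
    rw [SimpleGraph.connected_iff_exists_forall_reachable]
    exact ⟨⟨a, SimpleGraph.Reachable.refl a⟩, fun u => hconn u.1 u.2⟩
  have hle := hT.least T' hT' fun j hj => hall j hj
  have hsub : T'.verts ⊂ T.verts := by
    refine (Set.ssubset_iff_of_subset fun u hu => ?_).2 ⟨b, hab.snd_mem, hb⟩
    rcases Relation.ReflTransGen.cases_tail
      ((SimpleGraph.reachable_iff_reflTransGen _ _).1 hu) with h | ⟨v, _, h⟩
    · exact h ▸ hab.fst_mem
    · exact (hHT h).snd_mem
  exact absurd (Set.ncard_lt_ncard hsub (Set.toFinite _)) (not_lt.2 hle)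

/-- An edge of the smallest subtree is the only edge of `G` between two sets of terminals both of
which meet `A`. -/
theorem exists_separating_set (hG : G.IsTree) (hT : IsSmallestSubtree G A T) {a b : Fin m}
    (hab : T.Adj a b) :
    ∃ L : Set (Fin m), (∃ j ∈ A, j ∈ L) ∧ (∃ j ∈ A, j ∉ L) ∧
      ∀ u v, G.Adj u v → s(u, v) ≠ s(a, b) → (u ∈ L ↔ v ∈ L) := by
  set H := T.spanningCoe.deleteEdges {s(a, b)} with hH
  set G' := G.deleteEdges {s(a, b)} with hG'
  have hHG : H ≤ G' := by
    intro u v h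
    rw [SimpleGraph.deleteEdges_adj] at h ⊢
    exact ⟨T.adj_sub h.1, h.2⟩
  have hb : ¬ G'.Reachable a b := by
    have := (SimpleGraph.isAcyclic_iff_forall_isBridge.1 hG.isAcyclic)
      (e := s(a, b)) (T.adj_sub hab)
    rwa [SimpleGraph.isBridge_iff] at this
  have hcover : ∀ u ∈ T.verts, H.Reachable a u ∨ H.Reachable b u := by
    intro u hu
    have h := hT.isTree.1.preconnected ⟨a, hab.fst_mem⟩ ⟨u, hu⟩
    have h' := (SimpleGraph.reachable_iff_reflTransGen _ _).1 h
    have : ∀ w : T.verts, Relation.ReflTransGen T.coe.Adj ⟨a, hab.fst_mem⟩ w →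
        H.Reachable a w ∨ H.Reachable b w := by
      intro w hw
      induction hw with
      | refl => exact Or.inl (SimpleGraph.Reachable.refl _)
      | tail h1 h2 ih =>
        rename_i v w
        have h2' : T.Adj v w := h2
        by_cases he : s((v : Fin m), (w : Fin m)) = s(a, b)
        · rcases Sym2.eq_iff.1 he with ⟨_, h⟩ | ⟨_, h⟩
          · exact Or.inr (h ▸ SimpleGraph.Reachable.refl _)
          · exact Or.inl (h ▸ SimpleGraph.Reachable.refl _)
        · have hadj : H.Adj v w := SimpleGraph.deleteEdges_adj.2 ⟨h2', he⟩
          exact ih.imp (·.trans hadj.reachable) (·.trans hadj.reachable)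
    exact this ⟨u, hu⟩ h'
  obtain ⟨j₁, hj₁, h₁⟩ := exists_mem_not_reachable hG hT hab
  obtain ⟨j₂, hj₂, h₂⟩ := exists_mem_not_reachable hG hT hab.symm
  rw [Sym2.eq_swap] at h₂
  refine ⟨{u | G'.Reachable a u}, ⟨j₂, hj₂, ?_⟩, ⟨j₁, hj₁, ?_⟩, ?_⟩
  · exact ((hcover j₂ (hT.subset hj₂)).resolve_right h₂).mono hHG
  · intro h
    exact hb (h.trans (((hcover j₁ (hT.subset hj₁)).resolve_left h₁).mono hHG).symm)
  · intro u v huv hne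
    have hadj : G'.Adj u v := SimpleGraph.deleteEdges_adj.2 ⟨huv, hne⟩
    exact ⟨fun h => SimpleGraph.Reachable.trans h hadj.reachable,
      fun h => SimpleGraph.Reachable.trans h hadj.symm.reachable⟩

end Graph

/-! ### Protocols on the canonical model and the converse -/

theorem Protocol.messages_length_eq {m : ℕ} {𝒳 : Fin m → Type*} {A : Finset (Fin m)} {n k : ℕ}
    (π : Protocol 𝒳 A n k) (x x' : (j : Fin m) → Fin n → 𝒳 j) (t : ℕ) :
    (π.messages x t).length = (π.messages x' t).length := by
  induction t with
  | zero => rfl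
  | succ t ih =>
    simp only [Protocol.messages]
    split_ifs <;> simp [ih]

/-- The rectangle property: if two inputs give the same messages, so does every input that agrees
with the first on the terminals of `L` and with the second on the others. -/
theorem Protocol.messages_paste {m : ℕ} {𝒳 : Fin m → Type*} {A : Finset (Fin m)} {n k : ℕ}
    (π : Protocol 𝒳 A n k) (L : Set (Fin m)) {x x' y : (j : Fin m) → Fin n → 𝒳 j}
    (hx : ∀ j ∈ L, y j = x j) (hx' : ∀ j ∉ L, y j = x' j) (t : ℕ)
    (h : π.messages x t = π.messages x' t) : π.messages y t = π.messages x t := by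
  induction t with
  | zero => rfl
  | succ t ih =>
    simp only [Protocol.messages] at h ⊢
    split_ifs with ht
    · simp only [ht, dif_pos] at h
      obtain ⟨h1, h2⟩ := List.append_inj h (π.messages_length_eq x x' t)
      rw [ih h1]
      by_cases hs : π.speaker ⟨t, ht⟩ ∈ L
      · rw [hx _ hs]
      · rw [hx' _ hs, h2, h1]
    · simp only [ht, dif_neg, not_false_eq_true] at h
      exact ih h

section Block

variable {m : ℕ} {G : SimpleGraph (Fin m)} {𝒱 𝒵 : G.edgeSet → Type*}

/-- What terminal `j` observes if the edge variables and their wiretapped versions are given by the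
block `d`. -/
def blockObs {n : ℕ} (d : ∀ e, Fin n → 𝒱 e × 𝒵 e) (j : Fin m) (i : Fin n)
    (u : G.neighborSet j) : 𝒱 ⟨s(j, (u : Fin m)), u.2⟩ :=
  (d ⟨s(j, (u : Fin m)), u.2⟩ i).1

/-- What the wiretapper observes from the block `d`. -/
def blockTap {n : ℕ} (d : ∀ e, Fin n → 𝒱 e × 𝒵 e) (i : Fin n) (e : G.edgeSet) : 𝒵 e := (d e i).2

variable [Fintype G.edgeSet] {Ω : Type*} [MeasurableSpace Ω] (μ : Measure Ω)
  [IsProbabilityMeasure μ]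
  [∀ e, Countable (𝒱 e)] [∀ e, MeasurableSpace (𝒱 e)] [∀ e, MeasurableSingletonClass (𝒱 e)]
  [∀ e, Countable (𝒵 e)] [∀ e, MeasurableSpace (𝒵 e)] [∀ e, MeasurableSingletonClass (𝒵 e)]
  {V : (e : G.edgeSet) → Ω → 𝒱 e} {Z : (e : G.edgeSet) → Ω → 𝒵 e}

/-- The secret key conditions, transported to the canonical model. The transcript and the
wiretapper's observations are combined into one variable. -/
theorem isSecretKey_iff (hV : ∀ e, Measurable (V e)) (hZ : ∀ e, Measurable (Z e))
    (hpair : ∀ x : ∀ e, 𝒱 e × 𝒵 e,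
      μ {ω | ∀ e, (V e ω, Z e ω) = x e} = ∏ e, edgeLaw μ V Z e {x e})
    {A : Finset (Fin m)} {n k : ℕ}
    {π : Protocol (fun j => (i : G.neighborSet j) → 𝒱 ⟨s(j, (i : Fin m)), i.2⟩) A n k}
    {K : ((j : Fin m) → Fin n → (i : G.neighborSet j) → 𝒱 ⟨s(j, (i : Fin m)), i.2⟩) → Fin k}
    {ε σ : ℝ} :
    IsSecretKey μ (terminalVar G V) (fun ω e => Z e ω) A ε σ π K ↔
      (∀ j : A, 1 - ε ≤ (Measure.pi fun e => Measure.pi fun _ : Fin n => edgeLaw μ V Z e).real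
        {d | π.output j (blockObs d j) (π.transcript (blockObs d)) = K (blockObs d)}) ∧
      statDist
        (fun w : Fin k × (List ℕ × (Fin n → ∀ e, 𝒵 e)) =>
          (Measure.pi fun e => Measure.pi fun _ : Fin n => edgeLaw μ V Z e).real
            {d | K (blockObs d) = w.1 ∧ (π.transcript (blockObs d), blockTap d) = w.2})
        (fun w => 1 / (k : ℝ) *
          (Measure.pi fun e => Measure.pi fun _ : Fin n => edgeLaw μ V Z e).real
            {d | (π.transcript (blockObs d), blockTap d) = w.2}) ≤ ENNReal.ofReal σ := by
  set P := Measure.pi fun e => Measure.pi fun _ : Fin n => edgeLaw μ V Z e with hP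
  set D : (Fin n → Ω) → ∀ e, Fin n → 𝒱 e × 𝒵 e := fun ω e i => (V e (ω i), Z e (ω i)) with hD
  have hDm : Measurable D := by fun_prop
  have hmap : ∀ E : Set (∀ e, Fin n → 𝒱 e × 𝒵 e),
      P.real E = (Measure.pi fun _ : Fin n => μ).real (D ⁻¹' E) := by
    intro E
    rw [hP, ← map_blocks_eq_pi μ hV hZ hpair n,
      map_measureReal_apply hDm MeasurableSet.of_discrete]
  have hstat : ∀ w : Fin k × List ℕ × (Fin n → ∀ e, 𝒵 e),
      {ω : Fin n → Ω | K (samples (terminalVar G V) ω) = w.1 ∧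
        π.transcript (samples (terminalVar G V) ω) = w.2.1 ∧
        (fun i e => Z e (ω i)) = w.2.2} =
      D ⁻¹' {d | K (blockObs d) = w.1 ∧ (π.transcript (blockObs d), blockTap d) = w.2} := by
    intro w; ext ω
    simp only [Set.mem_preimage, Set.mem_ofPred_eq, Prod.ext_iff]
    rfl
  have hstat' : ∀ w : Fin k × List ℕ × (Fin n → ∀ e, 𝒵 e),
      {ω : Fin n → Ω | π.transcript (samples (terminalVar G V) ω) = w.2.1 ∧
        (fun i e => Z e (ω i)) = w.2.2} =
      D ⁻¹' {d | (π.transcript (blockObs d), blockTap d) = w.2} := by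
    intro w; ext ω
    simp only [Set.mem_preimage, Set.mem_ofPred_eq, Prod.ext_iff]
    rfl
  constructor
  · rintro ⟨h1, h2⟩
    refine ⟨fun j => ?_, ?_⟩
    · rw [hmap]; exact h1 j
    · simp_rw [hmap, ← hstat, ← hstat']; exact h2
  · rintro ⟨h1, h2⟩
    refine ⟨fun j => ?_, ?_⟩
    · have := h1 j; rw [hmap] at this; exact this
    · simp_rw [hmap, ← hstat, ← hstat'] at h2; exact h2

end Block

/-- Events determined by the coordinates in `S` and by those outside `S` are independent. -/
theorem pi_inter_restrict_eq_mul {ι : Type*} [Fintype ι] [DecidableEq ι] {β : ι → Type*}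
    [∀ i, MeasurableSpace (β i)] (ν : ∀ i, Measure (β i)) [∀ i, IsProbabilityMeasure (ν i)]
    [∀ i, Countable (β i)] [∀ i, DiscreteMeasurableSpace (β i)]
    (S : Finset ι) (E₁ E₂ : Set (∀ i, β i))
    (h₁ : ∀ x y : ∀ i, β i, (∀ i ∈ S, x i = y i) → x ∈ E₁ → y ∈ E₁)
    (h₂ : ∀ x y : ∀ i, β i, (∀ i ∉ S, x i = y i) → x ∈ E₂ → y ∈ E₂) :
    Measure.pi ν (E₁ ∩ E₂) = Measure.pi ν E₁ * Measure.pi ν E₂ := by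
  have hind : iIndepFun (fun i (x : ∀ i, β i) => x i) (Measure.pi ν) :=
    iIndepFun_pi (X := fun _ x => x) fun _ => aemeasurable_id
  have h := (hind.indepFun_finset S Sᶜ disjoint_compl_right
    fun i => measurable_pi_apply i).measure_inter_preimage_eq_mul
    {y | ∃ x ∈ E₁, ∀ i : S, x i = y i} {y | ∃ x ∈ E₂, ∀ i : (Sᶜ : Finset ι), x i = y i}
    MeasurableSet.of_discrete MeasurableSet.of_discrete
  have e1 : (fun (x : ∀ i, β i) (i : S) => x i) ⁻¹' {y | ∃ x ∈ E₁, ∀ i : S, x i = y i} = E₁ := by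
    ext x
    refine ⟨fun ⟨y, hy, h⟩ => h₁ y x (fun i hi => h ⟨i, hi⟩) hy, fun hx => ⟨x, hx, fun _ => rfl⟩⟩
  have e2 : (fun (x : ∀ i, β i) (i : (Sᶜ : Finset ι)) => x i) ⁻¹'
      {y | ∃ x ∈ E₂, ∀ i : (Sᶜ : Finset ι), x i = y i} = E₂ := by
    ext x
    refine ⟨fun ⟨y, hy, h⟩ => h₂ y x (fun i hi => h ⟨i, Finset.mem_compl.2 hi⟩) hy,
      fun hx => ⟨x, hx, fun _ => rfl⟩⟩
  rwa [e1, e2] at h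

section Converse

variable {m : ℕ} {G : SimpleGraph (Fin m)} {𝒱 𝒵 : G.edgeSet → Type*} [Fintype G.edgeSet]
  [∀ e, Countable (𝒱 e)] [∀ e, MeasurableSpace (𝒱 e)] [∀ e, MeasurableSingletonClass (𝒱 e)]
  [∀ e, Countable (𝒵 e)] [∀ e, MeasurableSpace (𝒵 e)] [∀ e, MeasurableSingletonClass (𝒵 e)]
  (κ : ∀ e, Measure (𝒱 e × 𝒵 e)) [∀ e, IsProbabilityMeasure (κ e)]
  {A : Finset (Fin m)} {n k : ℕ}
  (π : Protocol (fun j => (i : G.neighborSet j) → 𝒱 ⟨s(j, (i : Fin m)), i.2⟩) A n k)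

/-- The key that terminal `j` outputs on the block `d`. -/
def Protocol.blockOutput {m : ℕ} {G : SimpleGraph (Fin m)} {𝒱 𝒵 : G.edgeSet → Type*}
    {A : Finset (Fin m)} {n k : ℕ}
    (π : Protocol (fun j => (i : G.neighborSet j) → 𝒱 ⟨s(j, (i : Fin m)), i.2⟩) A n k)
    (j : A) (d : ∀ e, Fin n → 𝒱 e × 𝒵 e) : Fin k :=
  π.output j (blockObs d j) (π.transcript (blockObs d))

/-- If `e` is the only edge between `L` and its complement, then the output of a terminal in `L` can
be guessed from `V_e^n`, the communication and `Z^n`, at least as well as by a terminal outside `L`.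
-/
theorem exists_guess_of_separating [NeZero k] (e : G.edgeSet) (L : Set (Fin m))
    (hL : ∀ u v, G.Adj u v → s(u, v) ≠ (e : Sym2 (Fin m)) → (u ∈ L ↔ v ∈ L))
    (j₁ j₂ : A) (hj₁ : (j₁ : Fin m) ∈ L) (hj₂ : (j₂ : Fin m) ∉ L) :
    ∃ g : (Fin n → 𝒱 e) × (List ℕ × (Fin n → ∀ e, 𝒵 e)) → Fin k,
      (Measure.pi fun e => Measure.pi fun _ : Fin n => κ e)
        {d | π.blockOutput j₁ d = π.blockOutput j₂ d} ≤
      (Measure.pi fun e => Measure.pi fun _ : Fin n => κ e)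
        {d | π.blockOutput j₁ d =
          g (fun i => (d e i).1, (π.transcript (blockObs d), blockTap d))} := by
  classical
  refine exists_guess _ (fun d : ∀ e, Fin n → 𝒱 e × 𝒵 e =>
    ((fun i => (d e i).1, (π.transcript (blockObs d), blockTap d)) :
      (Fin n → 𝒱 e) × (List ℕ × (Fin n → ∀ e, 𝒵 e)))) _ _ fun w => ?_
  set W : (∀ e, Fin n → 𝒱 e × 𝒵 e) → (Fin n → 𝒱 e) × (List ℕ × (Fin n → ∀ e, 𝒵 e)) :=
    fun d => (fun i => (d e i).1, (π.transcript (blockObs d), blockTap d)) with hW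
  -- The edges on the side of `L`; given `V_e^n`, both sides then see disjoint sets of variables.
  set S : Finset G.edgeSet :=
    Finset.univ.filter fun e' => e' ≠ e ∧ ∃ u ∈ L, u ∈ (e' : Sym2 (Fin m)) with hS
  refine ⟨fun s => Measure.pi (fun e => Measure.pi fun _ : Fin n => κ e)
      {d | ∃ d', W d' = w ∧ π.blockOutput j₁ d' = s ∧ ∀ e' ∈ S, d' e' = d e'},
    fun s' => Measure.pi (fun e => Measure.pi fun _ : Fin n => κ e)
      {d | ∃ d', W d' = w ∧ π.blockOutput j₂ d' = s' ∧ ∀ e' ∉ S, d' e' = d e'}, fun s s' => ?_⟩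
  rw [← pi_inter_restrict_eq_mul (fun e => Measure.pi fun _ : Fin n => κ e) S]
  rotate_left
  · rintro x y hxy ⟨d', h1, h2, h3⟩
    exact ⟨d', h1, h2, fun e' he' => (h3 e' he').trans (hxy e' he')⟩
  · rintro x y hxy ⟨d', h1, h2, h3⟩
    exact ⟨d', h1, h2, fun e' he' => (h3 e' he').trans (hxy e' he')⟩
  congr 1
  ext d
  constructor
  · rintro ⟨h1, h2, h3⟩
    exact ⟨⟨d, h1, h2, fun _ _ => rfl⟩, ⟨d, h1, h3, fun _ _ => rfl⟩⟩
  rintro ⟨⟨x, hx1, hx2, hx3⟩, ⟨y, hy1, hy2, hy3⟩⟩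
  have heS : e ∉ S := by simp [hS]
  have hxy : W x = W y := hx1.trans hy1.symm
  have hxe : ∀ i, (x e i).1 = (d e i).1 := by
    intro i
    rw [← hy3 e heS]
    exact congrFun (congrArg Prod.fst hxy) i
  have hobs1 : ∀ j ∈ L, blockObs d j = blockObs x j := by
    intro j hj
    funext i u
    by_cases he : (⟨s(j, (u : Fin m)), u.2⟩ : G.edgeSet) = e
    · have := hxe i
      subst he
      exact this.symm
    · have hmem : (⟨s(j, (u : Fin m)), u.2⟩ : G.edgeSet) ∈ S := by
        rw [hS, Finset.mem_filter]
        exact ⟨Finset.mem_univ _, he, j, hj, Sym2.mem_mk_left _ _⟩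
      simp only [blockObs, hx3 _ hmem]
  have hobs2 : ∀ j ∉ L, blockObs d j = blockObs y j := by
    intro j hj
    funext i u
    have hmem : (⟨s(j, (u : Fin m)), u.2⟩ : G.edgeSet) ∉ S := by
      rw [hS, Finset.mem_filter]
      rintro ⟨_, he, v, hv, hvm⟩
      rcases Sym2.mem_iff.1 hvm with rfl | rfl
      · exact hj hv
      · exact hj ((hL j u u.2 fun h => he (Subtype.ext h)).2 hv)
    simp only [blockObs, hy3 _ hmem]
  have htr : π.transcript (blockObs d) = π.transcript (blockObs x) :=
    π.messages_paste L hobs1 hobs2 _ (congrArg (fun w => w.2.1) hxy)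
  have htap : blockTap d = blockTap x := by
    funext i e'
    by_cases he : e' ∈ S
    · simp only [blockTap, hx3 _ he]
    · have h1 : (x e' i).2 = (y e' i).2 :=
        congrFun (congrFun (congrArg (fun w => w.2.2) hxy) i) e'
      rw [hy3 _ he] at h1
      exact h1.symm
  have hWd : W d = w := by
    rw [← hx1]
    simp only [hW, htr, htap]
    congr 1
    funext i
    exact (hxe i).symm
  have htr' : π.transcript (blockObs d) = π.transcript (blockObs y) :=
    htr.trans (congrArg (fun w => w.2.1) hxy)
  refine ⟨hWd, ?_, ?_⟩
  · rw [← hx2, Protocol.blockOutput, Protocol.blockOutput, htr, hobs1 _ hj₁]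
  · rw [← hy2, Protocol.blockOutput, Protocol.blockOutput, htr', hobs2 _ hj₂]

theorem measureReal_and_ge {D : Type*} [MeasurableSpace D] [DiscreteMeasurableSpace D]
    (P : Measure D) [IsProbabilityMeasure P] (E F : Set D) :
    P.real E + P.real F - 1 ≤ P.real (E ∩ F) := by
  have h1 := measureReal_union_add_inter (μ := P) (s := E) (t := F) MeasurableSet.of_discrete
  have h2 : P.real (E ∪ F) ≤ 1 := measureReal_le_one
  linarith

/-- The single-shot converse. With `c = 2 ^ (-n r)`, the number of blocks of conditional probability
at least `c` is at most `c⁻¹ = 2 ^ (n r)`. -/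
theorem converse_bound [NeZero k] (e : G.edgeSet) (L : Set (Fin m))
    (hL : ∀ u v, G.Adj u v → s(u, v) ≠ (e : Sym2 (Fin m)) → (u ∈ L ↔ v ∈ L))
    (j₁ j₂ : A) (hj₁ : (j₁ : Fin m) ∈ L) (hj₂ : (j₂ : Fin m) ∉ L)
    (K : (∀ e, Fin n → 𝒱 e × 𝒵 e) → Fin k) {ε σ c : ℝ} (hσ : 0 ≤ σ) (hc : 0 < c)
    (hrel : ∀ j : A, 1 - ε ≤ (Measure.pi fun e => Measure.pi fun _ : Fin n => κ e).real
      {d | π.blockOutput j d = K d})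
    (hsec : statDist
        (fun w : Fin k × (List ℕ × (Fin n → ∀ e, 𝒵 e)) =>
          (Measure.pi fun e => Measure.pi fun _ : Fin n => κ e).real
            {d | K d = w.1 ∧ (π.transcript (blockObs d), blockTap d) = w.2})
        (fun w => 1 / (k : ℝ) *
          (Measure.pi fun e => Measure.pi fun _ : Fin n => κ e).real
            {d | (π.transcript (blockObs d), blockTap d) = w.2}) ≤ ENNReal.ofReal σ) :
    1 - 3 * ε - 2 * σ - (Measure.pi fun _ : Fin n => κ e).real
      {x | ∏ i, condProb (κ e) (x i) < c} ≤ c⁻¹ / k := by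
  classical
  set P := Measure.pi fun e => Measure.pi fun _ : Fin n => κ e with hP
  let _ : MeasurableSpace (List ℕ) := ⊤
  have _ : DiscreteMeasurableSpace (List ℕ) := ⟨fun _ => trivial⟩
  obtain ⟨g, hg⟩ := exists_guess_of_separating κ π e L hL j₁ j₂ hj₁ hj₂
  set Y : (∀ e, Fin n → 𝒱 e × 𝒵 e) → List ℕ × (Fin n → ∀ e, 𝒵 e) :=
    fun d => (π.transcript (blockObs d), blockTap d) with hY
  have hg' : P.real {d | π.blockOutput j₁ d = π.blockOutput j₂ d} ≤
      P.real {d | π.blockOutput j₁ d = g (fun i => (d e i).1, Y d)} :=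
    ENNReal.toReal_mono (measure_ne_top _ _) hg
  have h1 : 1 - 2 * ε ≤ P.real {d | π.blockOutput j₁ d = π.blockOutput j₂ d} := by
    have h := measureReal_and_ge P {d | π.blockOutput j₁ d = K d} {d | π.blockOutput j₂ d = K d}
    have h' : P.real ({d | π.blockOutput j₁ d = K d} ∩ {d | π.blockOutput j₂ d = K d}) ≤
        P.real {d | π.blockOutput j₁ d = π.blockOutput j₂ d} :=
      measureReal_mono fun d hd => Eq.trans hd.1 (Eq.symm hd.2)
    linarith [hrel j₁, hrel j₂]
  have h2 : 1 - 3 * ε ≤ P.real {d | K d = g (fun i => (d e i).1, Y d)} := by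
    have h := measureReal_and_ge P {d | π.blockOutput j₁ d = K d}
      {d | π.blockOutput j₁ d = g (fun i => (d e i).1, Y d)}
    have h' : P.real ({d | π.blockOutput j₁ d = K d} ∩
        {d | π.blockOutput j₁ d = g (fun i => (d e i).1, Y d)}) ≤
        P.real {d | K d = g (fun i => (d e i).1, Y d)} :=
      measureReal_mono fun d hd => Eq.trans (Eq.symm hd.1) hd.2
    linarith [hrel j₁]
  set η := (Measure.pi fun _ : Fin n => κ e).real {x | ∏ i, condProb (κ e) (x i) < c}
  have h3 : P.real {d | ∏ i, condProb (κ e) (d e i) < c} = η := by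
    have hmp := measurePreserving_eval (fun e => Measure.pi fun _ : Fin n => κ e) e
    exact hmp.measureReal_preimage (s := {x | ∏ i, condProb (κ e) (x i) < c})
      MeasurableSet.of_discrete.nullMeasurableSet
  have h3' : P.real {d | c ≤ ∏ i, condProb (κ e) (d e i)} = 1 - η := by
    rw [← h3, ← probReal_compl_eq_one_sub MeasurableSet.of_discrete]
    congr 1; ext d; simp
  -- The values of the guess over all typical `v`; the communication and `Z^n` determine this set.
  set E : Set (Fin k × (List ℕ × (Fin n → ∀ e, 𝒵 e))) :=
    {w | ∃ v : Fin n → 𝒱 e, c ≤ ∏ i, condProb (κ e) (v i, w.2.2 i e) ∧ w.1 = g (v, w.2)} with hE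
  have h4 : 1 - 3 * ε - η ≤ P.real {d | (K d, Y d) ∈ E} := by
    have h := measureReal_and_ge P {d | K d = g (fun i => (d e i).1, Y d)}
      {d | c ≤ ∏ i, condProb (κ e) (d e i)}
    have h' : P.real ({d | K d = g (fun i => (d e i).1, Y d)} ∩
        {d | c ≤ ∏ i, condProb (κ e) (d e i)}) ≤ P.real {d | (K d, Y d) ∈ E} :=
      measureReal_mono fun d hd => ⟨fun i => (d e i).1, hd.2, hd.1⟩
    linarith
  have h5 := measure_key_le P Y K hσ hsec E (inv_nonneg.2 hc.le) (by
    intro y S hS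
    have _ : Nonempty (𝒱 e) := (nonempty_of_isProbabilityMeasure (κ e)).map Prod.fst
    choose! v hv hvg using hS
    have hinj : Set.InjOn v (S : Set (Fin k)) := by
      intro s hs s' hs' h
      have e1 := hvg s hs
      have e2 := hvg s' hs'
      simp only at e1 e2
      rw [e1, e2, h]
    rw [← Finset.card_image_of_injOn hinj]
    refine card_le_of_le_prod_condProb (κ e) hc (fun i => y.2 i e) _ fun v' hv' => ?_
    obtain ⟨s, hs, rfl⟩ := Finset.mem_image.1 hv'
    exact hv s hs)
  linarith

end Converse

/-! ### Key agreement by public differences -/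

section Protocol

variable {m : ℕ} {G : SimpleGraph (Fin m)} {k : ℕ} [NeZero k]

open Classical in
/-- The differences of the keys of any two edges of `T` at terminal `j`, with `0` for pairs that are
not both edges of `T`. -/
noncomputable def keyDiff (T : G.Subgraph) (j : Fin m) (s : G.neighborSet j → Fin k)
    (p : G.neighborSet j × G.neighborSet j) : Fin k :=
  if T.Adj j p.1 ∧ T.Adj j p.2 then s p.1 - s p.2 else 0

/-- The message of terminal `j`: its key differences, encoded as a natural number. -/
noncomputable def keyMessage (T : G.Subgraph) (j : Fin m) (s : G.neighborSet j → Fin k) : ℕ :=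
  (Countable.exists_injective_nat (G.neighborSet j × G.neighborSet j → Fin k)).choose
    (keyDiff T j s)

/-- The public communication as a function of the edge keys: one message of each terminal. -/
noncomputable def keyTranscript (T : G.Subgraph) (s : G.edgeSet → Fin k) : List ℕ :=
  (List.finRange m).map fun j => keyMessage T j fun u => s ⟨s(j, (u : Fin m)), u.2⟩

theorem keyMessage_eq_iff {T : G.Subgraph} {j : Fin m} {s s' : G.neighborSet j → Fin k} :
    keyMessage T j s = keyMessage T j s' ↔ keyDiff T j s = keyDiff T j s' :=
  (Countable.exists_injective_nat
    (G.neighborSet j × G.neighborSet j → Fin k)).choose_spec.eq_iff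

open Classical in
/-- Translating the keys of all edges of `T` by the same amount leaves the communication unchanged.
-/
theorem keyTranscript_shift (T : G.Subgraph) (s : G.edgeSet → Fin k) (t : Fin k) :
    keyTranscript T (fun e => if (e : Sym2 (Fin m)) ∈ T.edgeSet then s e + t else s e) =
      keyTranscript T s := by
  refine List.map_congr_left fun j _ => keyMessage_eq_iff.2 (funext fun p => ?_)
  unfold keyDiff
  split_ifs with h
  · simp [h.1, h.2]
  · rfl

/-- As `T` is connected, the communication determines the difference of the keys of any two of its
edges. -/
theorem sub_eq_sub_of_keyTranscript_eq {T : G.Subgraph} (hT : T.coe.IsTree)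
    {s s' : G.edgeSet → Fin k} (h : keyTranscript T s = keyTranscript T s') {a b u v : Fin m}
    (hab : T.Adj a b) (huv : T.Adj u v) :
    s ⟨s(u, v), T.adj_sub huv⟩ - s ⟨s(a, b), T.adj_sub hab⟩ =
      s' ⟨s(u, v), T.adj_sub huv⟩ - s' ⟨s(a, b), T.adj_sub hab⟩ := by
  have hloc : ∀ j v w (hv : T.Adj j v) (hw : T.Adj j w),
      s ⟨s(j, v), T.adj_sub hv⟩ - s ⟨s(j, w), T.adj_sub hw⟩ =
        s' ⟨s(j, v), T.adj_sub hv⟩ - s' ⟨s(j, w), T.adj_sub hw⟩ := by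
    intro j v w hv hw
    have h1 := List.map_inj_left.1 h j (List.mem_finRange j)
    have h2 := congrFun (keyMessage_eq_iff.1 h1) (⟨v, T.adj_sub hv⟩, ⟨w, T.adj_sub hw⟩)
    simpa [keyDiff, hv, hw] using h2
  have hmain : ∀ w : T.verts, Relation.ReflTransGen T.coe.Adj ⟨a, hab.fst_mem⟩ w →
      ∀ v (hv : T.Adj w v), s ⟨s((w : Fin m), v), T.adj_sub hv⟩ - s ⟨s(a, b), T.adj_sub hab⟩ =
        s' ⟨s((w : Fin m), v), T.adj_sub hv⟩ - s' ⟨s(a, b), T.adj_sub hab⟩ := by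
    intro w hw
    induction hw with
    | refl => exact fun v hv => hloc a v b hv hab
    | tail h1 h2 ih =>
      rename_i x y
      intro v hv
      have h2' : T.Adj x y := h2
      have e1 := ih y h2'
      have e2 := hloc y v x hv h2'.symm
      have e3 : (⟨s((y : Fin m), (x : Fin m)), T.adj_sub h2'.symm⟩ : G.edgeSet) =
          ⟨s((x : Fin m), (y : Fin m)), T.adj_sub h2'⟩ := Subtype.ext Sym2.eq_swap
      rw [e3] at e2
      rw [← sub_add_sub_cancel, e2, e1, sub_add_sub_cancel]
  exact hmain ⟨u, huv.fst_mem⟩ ((SimpleGraph.reachable_iff_reflTransGen _ _).1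
    (hT.1.preconnected ⟨a, hab.fst_mem⟩ ⟨u, huv.fst_mem⟩)) v huv

variable {𝒱 : G.edgeSet → Type*} {A : Finset (Fin m)} {n : ℕ}

/-- The protocol: terminal `j` hashes the variables of its edges with `h` and broadcasts the key
differences. It outputs the key of its edge to `nb j`, corrected by a function `corr j` of the
communication that is meant to be the difference from the common key. -/
noncomputable def treeProtocol (T : G.Subgraph) (h : ∀ e, (Fin n → 𝒱 e) → Fin k)
    (nb : ∀ j : A, G.neighborSet j) (corr : A → List ℕ → Fin k) :
    Protocol (fun j => (i : G.neighborSet j) → 𝒱 ⟨s(j, (i : Fin m)), i.2⟩) A n k where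
  rounds := m
  speaker := id
  message := fun j x _ => keyMessage T j fun u => h ⟨s(j, (u : Fin m)), u.2⟩ fun i => x i u
  output := fun j x f => h ⟨s((j : Fin m), (nb j : Fin m)), (nb j).2⟩ (fun i => x i (nb j)) -
    corr j f

theorem treeProtocol_messages (T : G.Subgraph) (h : ∀ e, (Fin n → 𝒱 e) → Fin k)
    (nb : ∀ j : A, G.neighborSet j) (corr : A → List ℕ → Fin k)
    (x : (j : Fin m) → Fin n → (i : G.neighborSet j) → 𝒱 ⟨s(j, (i : Fin m)), i.2⟩) (t : ℕ) :
    (treeProtocol T h nb corr).messages x t = ((List.finRange m).map fun j =>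
      keyMessage T j fun u => h ⟨s(j, (u : Fin m)), u.2⟩ fun i => x j i u).take t := by
  induction t with
  | zero => rfl
  | succ t ih =>
    rw [Protocol.messages, List.take_add_one, ih]
    split_ifs with ht
    · have ht' : t < m := ht
      have hget : ∀ f : Fin m → ℕ, ((List.finRange m).map f)[t]? = some (f ⟨t, ht'⟩) := by
        intro f; simp [ht']
      rw [hget]
      rfl
    · have ht' : ¬ t < m := ht
      simp [not_lt.1 ht']

theorem treeProtocol_transcript {𝒵 : G.edgeSet → Type*} (T : G.Subgraph)
    (h : ∀ e, (Fin n → 𝒱 e) → Fin k)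
    (nb : ∀ j : A, G.neighborSet j) (corr : A → List ℕ → Fin k)
    (d : ∀ e, Fin n → 𝒱 e × 𝒵 e) :
    (treeProtocol T h nb corr).transcript (blockObs d) =
      keyTranscript T fun e => h e fun i => (d e i).1 := by
  rw [Protocol.transcript, treeProtocol_messages]
  exact List.take_of_length_le (by simp [treeProtocol])

end Protocol

section Secrecy

variable {m : ℕ} {G : SimpleGraph (Fin m)} {𝒱 𝒵 : G.edgeSet → Type*} [Fintype G.edgeSet]
  [∀ e, Countable (𝒱 e)] [∀ e, MeasurableSpace (𝒱 e)] [∀ e, MeasurableSingletonClass (𝒱 e)]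
  [∀ e, Countable (𝒵 e)] [∀ e, MeasurableSpace (𝒵 e)] [∀ e, MeasurableSingletonClass (𝒵 e)]
  {n k : ℕ} [NeZero k]

/-- The key of `e₀` is almost translation invariant jointly with the communication and `Z^n`:
translate the keys of all edges of `T` together. -/
theorem measure_shift_le (κ : ∀ e, Measure (𝒱 e × 𝒵 e)) [∀ e, IsProbabilityMeasure (κ e)]
    (T : G.Subgraph) (h : ∀ e, (Fin n → 𝒱 e) → Fin k) {δ : G.edgeSet → ℝ} (hδ : ∀ e, 0 ≤ δ e)
    (hh : ∀ e : G.edgeSet, (e : Sym2 (Fin m)) ∈ T.edgeSet →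
      ∀ (t : Fin k) (E : Set (Fin k × (Fin n → 𝒵 e))),
        (Measure.pi fun _ : Fin n => κ e).real
            {x | (h e fun i => (x i).1, fun i => (x i).2) ∈ E} ≤
          (Measure.pi fun _ : Fin n => κ e).real
            {x | ((h e fun i => (x i).1) + t, fun i => (x i).2) ∈ E} + δ e)
    {e₀ : G.edgeSet} (he₀ : (e₀ : Sym2 (Fin m)) ∈ T.edgeSet) (t : Fin k)
    (E : Set (Fin k × (List ℕ × (Fin n → ∀ e, 𝒵 e)))) :
    (Measure.pi fun e => Measure.pi fun _ : Fin n => κ e)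
        {d | (h e₀ fun i => (d e₀ i).1,
          keyTranscript T fun e => h e fun i => (d e i).1, blockTap d) ∈ E} ≤
      (Measure.pi fun e => Measure.pi fun _ : Fin n => κ e)
        {d | ((h e₀ fun i => (d e₀ i).1) + t,
          keyTranscript T fun e => h e fun i => (d e i).1, blockTap d) ∈ E} +
      ENNReal.ofReal (∑ e, δ e) := by
  classical
  set sh : G.edgeSet → Fin k → Fin k :=
    fun e s => if (e : Sym2 (Fin m)) ∈ T.edgeSet then s + t else s with hsh
  set φ : ∀ e, (Fin n → 𝒱 e × 𝒵 e) → Fin k × (Fin n → 𝒵 e) :=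
    fun e x => (h e fun i => (x i).1, fun i => (x i).2) with hφ
  set φ' : ∀ e, (Fin n → 𝒱 e × 𝒵 e) → Fin k × (Fin n → 𝒵 e) :=
    fun e x => (sh e (h e fun i => (x i).1), fun i => (x i).2) with hφ'
  set ν := fun e => Measure.pi fun _ : Fin n => κ e with hν
  have hp : ∀ e, IsProbabilityMeasure ((ν e).map (φ e)) := fun e =>
    Measure.isProbabilityMeasure_map Measurable.of_discrete.aemeasurable
  have hp' : ∀ e, IsProbabilityMeasure ((ν e).map (φ' e)) := fun e =>
    Measure.isProbabilityMeasure_map Measurable.of_discrete.aemeasurable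
  set F : Set (∀ e, Fin k × (Fin n → 𝒵 e)) :=
    {q | ((q e₀).1, keyTranscript T fun e => (q e).1, fun i e => (q e).2 i) ∈ E} with hF
  have hyb := pi_le_pi_add_sum (fun e => (ν e).map (φ e)) (fun e => (ν e).map (φ' e))
    (fun e => ENNReal.ofReal (δ e)) (fun e B hB => by
      rw [Measure.map_apply Measurable.of_discrete hB, Measure.map_apply Measurable.of_discrete hB]
      by_cases he : (e : Sym2 (Fin m)) ∈ T.edgeSet
      · have h1 := hh e he t B
        have h2 : φ' e ⁻¹' B = {x | ((h e fun i => (x i).1) + t, fun i => (x i).2) ∈ B} := by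
          ext x; simp [hφ', hsh, he]
        rw [h2, ← ofReal_measureReal, ← ofReal_measureReal,
          ← ENNReal.ofReal_add measureReal_nonneg (hδ e)]
        exact ENNReal.ofReal_le_ofReal h1
      · have h2 : φ' e = φ e := by
          funext x; simp [hφ', hφ, hsh, he]
        rw [h2]
        exact le_self_add) (B := F) MeasurableSet.of_discrete
  rw [← Measure.pi_map_pi fun e => Measurable.of_discrete.aemeasurable,
    ← Measure.pi_map_pi fun e => Measurable.of_discrete.aemeasurable,
    Measure.map_apply Measurable.of_discrete MeasurableSet.of_discrete,
    Measure.map_apply Measurable.of_discrete MeasurableSet.of_discrete,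
    ← ENNReal.ofReal_sum_of_nonneg fun e _ => hδ e] at hyb
  refine hyb.trans (le_of_eq ?_)
  congr 2
  ext d
  have h1 := keyTranscript_shift T (fun e => h e fun i => (d e i).1) t
  simp only [hF, hφ', hsh, Set.mem_preimage, Set.mem_ofPred_eq, he₀, if_true]
  rw [h1]
  rfl

theorem exists_isSecretKey {Ω : Type*} [MeasurableSpace Ω] (μ : Measure Ω)
    [IsProbabilityMeasure μ] {V : (e : G.edgeSet) → Ω → 𝒱 e} {Z : (e : G.edgeSet) → Ω → 𝒵 e}
    (hV : ∀ e, Measurable (V e)) (hZ : ∀ e, Measurable (Z e))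
    (hpair : ∀ x : ∀ e, 𝒱 e × 𝒵 e,
      μ {ω | ∀ e, (V e ω, Z e ω) = x e} = ∏ e, edgeLaw μ V Z e {x e})
    {A : Finset (Fin m)} {T : G.Subgraph} (hT : T.coe.IsTree)
    (hA : ∀ j ∈ A, ∃ u, T.Adj j u) {a b : Fin m} (hab : T.Adj a b)
    (h : ∀ e, (Fin n → 𝒱 e) → Fin k) {δ : G.edgeSet → ℝ} (hδ : ∀ e, 0 ≤ δ e)
    (hh : ∀ e : G.edgeSet, (e : Sym2 (Fin m)) ∈ T.edgeSet →
      ∀ (t : Fin k) (E : Set (Fin k × (Fin n → 𝒵 e))),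
        (Measure.pi fun _ : Fin n => edgeLaw μ V Z e).real
            {x | (h e fun i => (x i).1, fun i => (x i).2) ∈ E} ≤
          (Measure.pi fun _ : Fin n => edgeLaw μ V Z e).real
            {x | ((h e fun i => (x i).1) + t, fun i => (x i).2) ∈ E} + δ e)
    {ε σ : ℝ} (hε : 0 ≤ ε) (hσ : ∑ e, δ e ≤ σ) :
    ∃ (π : Protocol (fun j => (i : G.neighborSet j) → 𝒱 ⟨s(j, (i : Fin m)), i.2⟩) A n k)
      (K : ((j : Fin m) → Fin n → (i : G.neighborSet j) → 𝒱 ⟨s(j, (i : Fin m)), i.2⟩) → Fin k),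
      IsSecretKey μ (terminalVar G V) (fun ω e => Z e ω) A ε σ π K := by
  have := fun e => isProbabilityMeasure_edgeLaw μ hV hZ e
  choose! u hu using hA
  set e₀ : G.edgeSet := ⟨s(a, b), T.adj_sub hab⟩ with he₀
  set nb : ∀ j : A, G.neighborSet j := fun j => ⟨u j, T.adj_sub (hu j j.2)⟩ with hnb
  set ej : A → G.edgeSet := fun j => ⟨s((j : Fin m), u j), T.adj_sub (hu j j.2)⟩ with hej
  have hcorr : ∀ j : A, ∃ c : List ℕ → Fin k, ∀ s : G.edgeSet → Fin k,
      c (keyTranscript T s) = s (ej j) - s e₀ := by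
    intro j
    have hfac : Function.FactorsThrough (fun s : G.edgeSet → Fin k => s (ej j) - s e₀)
        (keyTranscript T) := fun s s' hs =>
      sub_eq_sub_of_keyTranscript_eq hT hs hab (hu j j.2)
    exact ⟨Function.extend (keyTranscript T) _ fun _ => 0, fun s => hfac.extend_apply _ s⟩
  choose corr hcorr using hcorr
  refine ⟨treeProtocol T h nb corr, fun x => h e₀ fun i => x a i ⟨b, T.adj_sub hab⟩,
    (isSecretKey_iff μ hV hZ hpair).2 ⟨fun j => ?_, ?_⟩⟩
  · have : {d : ∀ e, Fin n → 𝒱 e × 𝒵 e | (treeProtocol T h nb corr).output j (blockObs d j)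
        ((treeProtocol T h nb corr).transcript (blockObs d)) =
        h e₀ fun i => blockObs d a i ⟨b, T.adj_sub hab⟩} = Set.univ := by
      refine Set.eq_univ_of_forall fun d => ?_
      change h (ej j) (fun i => (d (ej j) i).1) - corr j _ = h e₀ fun i => (d e₀ i).1
      rw [treeProtocol_transcript, hcorr, sub_sub_cancel]
    rw [this, probReal_univ]
    linarith
  · let _ : MeasurableSpace (List ℕ) := ⊤
    have _ : DiscreteMeasurableSpace (List ℕ) := ⟨fun _ => trivial⟩
    have hS : 0 ≤ ∑ e, δ e := Finset.sum_nonneg fun e _ => hδ e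
    refine (statDist_key_le_of_shift (Measure.pi fun e => Measure.pi fun _ : Fin n =>
      edgeLaw μ V Z e) _ _ (δ := ENNReal.ofReal (∑ e, δ e)) fun t E => ?_).trans
      (ENNReal.ofReal_le_ofReal hσ)
    simp only [treeProtocol_transcript]
    exact measure_shift_le (edgeLaw μ V Z) T h hδ hh (e₀ := e₀) hab t E

end Secrecy

/-! ### The capacity -/

section Capacity

variable {m : ℕ} {G : SimpleGraph (Fin m)} {𝒱 𝒵 : G.edgeSet → Type*} [Fintype G.edgeSet]
  [∀ e, Countable (𝒱 e)] [∀ e, MeasurableSpace (𝒱 e)] [∀ e, MeasurableSingletonClass (𝒱 e)]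
  [∀ e, Countable (𝒵 e)] [∀ e, MeasurableSpace (𝒵 e)] [∀ e, MeasurableSingletonClass (𝒵 e)]
  {Ω : Type*} [MeasurableSpace Ω] (μ : Measure Ω) [IsProbabilityMeasure μ]
  {V : (e : G.edgeSet) → Ω → 𝒱 e} {Z : (e : G.edgeSet) → Ω → 𝒵 e}
  {A : Finset (Fin m)} {T : G.Subgraph}

theorem maxKeyLength_le (hV : ∀ e, Measurable (V e)) (hZ : ∀ e, Measurable (Z e))
    (hpair : ∀ x : ∀ e, 𝒱 e × 𝒵 e,
      μ {ω | ∀ e, (V e ω, Z e ω) = x e} = ∏ e, edgeLaw μ V Z e {x e})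
    (e : G.edgeSet) {L : Set (Fin m)}
    (hL : ∀ u v, G.Adj u v → s(u, v) ≠ (e : Sym2 (Fin m)) → (u ∈ L ↔ v ∈ L))
    (hL₁ : ∃ j ∈ A, j ∈ L) (hL₂ : ∃ j ∈ A, j ∉ L) {n : ℕ} {ε σ r : ℝ} (hσ : 0 ≤ σ)
    (hsmall : 1 / 2 ≤ 1 - 3 * ε - 2 * σ - (Measure.pi fun _ : Fin n => edgeLaw μ V Z e).real
      {x | ∏ i, condProb (edgeLaw μ V Z e) (x i) < (2 : ℝ) ^ (-(n * r))}) :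
    maxKeyLength μ (terminalVar G V) (fun ω e => Z e ω) A n ε σ ≤ ENNReal.ofReal (1 + n * r) := by
  have := fun e => isProbabilityMeasure_edgeLaw μ hV hZ e
  obtain ⟨j₁, hj₁, hj₁L⟩ := hL₁
  obtain ⟨j₂, hj₂, hj₂L⟩ := hL₂
  refine iSup₂_le fun k hk => ENNReal.ofReal_le_ofReal ?_
  obtain ⟨hk1, π, K, hK⟩ := hk
  have : NeZero k := ⟨by omega⟩
  have hk0 : (0 : ℝ) < k := by exact_mod_cast hk1
  obtain ⟨hrel, hsec⟩ := (isSecretKey_iff μ hV hZ hpair).1 hK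
  have hc : (0 : ℝ) < 2 ^ (-(n * r)) := Real.rpow_pos_of_pos two_pos _
  have h := converse_bound (edgeLaw μ V Z) π e L hL ⟨j₁, hj₁⟩ ⟨j₂, hj₂⟩ hj₁L hj₂L
    (fun d => K (blockObs d)) hσ hc hrel hsec
  have h1 := hsmall.trans h
  rw [← Real.rpow_neg zero_le_two, neg_neg, le_div_iff₀ hk0] at h1
  have h2 : (k : ℝ) ≤ 2 ^ (1 + n * r) := by
    rw [Real.rpow_add two_pos, Real.rpow_one]; linarith
  exact (Real.logb_le_iff_le_rpow one_lt_two hk0).2 h2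

theorem wskCapacity_le (hV : ∀ e, Measurable (V e)) (hZ : ∀ e, Measurable (Z e))
    (hpair : ∀ x : ∀ e, 𝒱 e × 𝒵 e,
      μ {ω | ∀ e, (V e ω, Z e ω) = x e} = ∏ e, edgeLaw μ V Z e {x e})
    (e : G.edgeSet) {L : Set (Fin m)}
    (hL : ∀ u v, G.Adj u v → s(u, v) ≠ (e : Sym2 (Fin m)) → (u ∈ L ↔ v ∈ L))
    (hL₁ : ∃ j ∈ A, j ∈ L) (hL₂ : ∃ j ∈ A, j ∉ L) :
    wskCapacity μ (terminalVar G V) (fun ω e => Z e ω) A ≤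
      condEntropy μ (V e) (fun ω e' => Z e' ω) := by
  have := fun e => isProbabilityMeasure_edgeLaw μ hV hZ e
  rw [condEntropy_edge μ hV hZ hpair]
  refine iSup_le fun ε => iSup_le fun σ => iSup_le fun ⟨hε, hσ, hεσ⟩ => ?_
  refine le_of_forall_gt fun c hc => ?_
  obtain ⟨c', hc1, hc2⟩ := exists_between hc
  have hc't : c' ≠ ∞ := ne_top_of_lt hc2
  refine lt_of_le_of_lt ?_ hc2
  set r := c'.toReal
  have hr : ENNReal.ofReal r = c' := ENNReal.ofReal_toReal hc't
  rw [← hr] at hc1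
  have hη : Tendsto (fun n : ℕ => (Measure.pi fun _ : Fin n => edgeLaw μ V Z e).real
      {x | ∏ i, condProb (edgeLaw μ V Z e) (x i) < (2 : ℝ) ^ (-(n * r))}) atTop (𝓝 0) := by
    have := (ENNReal.tendsto_toReal ENNReal.zero_ne_top).comp (tendsto_pi_prod_condProb_lt _ hc1)
    exact this
  have hε0 : Tendsto ε atTop (𝓝 0) :=
    tendsto_of_tendsto_of_tendsto_of_le_of_le tendsto_const_nhds hεσ (fun n => (hε n).le)
      fun n => le_add_of_nonneg_right (hσ n).le
  have hσ0 : Tendsto σ atTop (𝓝 0) :=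
    tendsto_of_tendsto_of_tendsto_of_le_of_le tendsto_const_nhds hεσ (fun n => (hσ n).le)
      fun n => le_add_of_nonneg_left (hε n).le
  have hlim := ((tendsto_const_nhds (x := (1 : ℝ))).sub (hε0.const_mul 3)).sub
    (hσ0.const_mul 2) |>.sub hη
  simp only [mul_zero, sub_zero] at hlim
  have hev : ∀ᶠ n : ℕ in atTop,
      maxKeyLength μ (terminalVar G V) (fun ω e => Z e ω) A n (ε n) (σ n) / (n : ℝ≥0∞) ≤
        ENNReal.ofReal (1 / n + r) := by
    filter_upwards [hlim.eventually_const_le (by norm_num : (1 / 2 : ℝ) < 1),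
      eventually_gt_atTop 0] with n hn hn0
    have hn0' : (0 : ℝ) < n := by exact_mod_cast hn0
    have h1 := maxKeyLength_le μ hV hZ hpair e hL hL₁ hL₂ (hσ n).le hn
    calc _ ≤ ENNReal.ofReal (1 + n * r) / (n : ℝ≥0∞) := by gcongr
      _ = ENNReal.ofReal ((1 + n * r) / n) := by
        rw [ENNReal.ofReal_div_of_pos hn0', ENNReal.ofReal_natCast]
      _ = _ := by congr 1; field_simp
  have hlim2 : Tendsto (fun n : ℕ => ENNReal.ofReal (1 / n + r)) atTop (𝓝 c') := by
    rw [← hr]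
    refine ENNReal.tendsto_ofReal ?_
    simpa using (tendsto_one_div_atTop_nhds_zero_nat (𝕜 := ℝ)).add_const r
  exact (liminf_le_liminf hev).trans hlim2.liminf_eq.le

theorem ofReal_le_wskCapacity (hV : ∀ e, Measurable (V e)) (hZ : ∀ e, Measurable (Z e))
    (hpair : ∀ x : ∀ e, 𝒱 e × 𝒵 e,
      μ {ω | ∀ e, (V e ω, Z e ω) = x e} = ∏ e, edgeLaw μ V Z e {x e})
    (hT : T.coe.IsTree) (hA : ∀ j ∈ A, ∃ u, T.Adj j u) {a b : Fin m} (hab : T.Adj a b)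
    {R : ℝ} (hR0 : 0 ≤ R) (hR : ∀ e : G.edgeSet, (e : Sym2 (Fin m)) ∈ T.edgeSet →
      ENNReal.ofReal R < condEntropy μ (V e) (fun ω e' => Z e' ω)) :
    ENNReal.ofReal R ≤ wskCapacity μ (terminalVar G V) (fun ω e => Z e ω) A := by
  have := fun e => isProbabilityMeasure_edgeLaw μ hV hZ e
  have hδ : ∀ e : G.edgeSet, ∃ δ : ℕ → ℝ, (∀ n, 0 ≤ δ n) ∧ Tendsto δ atTop (𝓝 0) ∧
      ∀ (n k : ℕ) [NeZero k], (k : ℝ) ≤ 2 ^ (n * R) → ∃ h : (Fin n → 𝒱 e) → Fin k,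
        (e : Sym2 (Fin m)) ∈ T.edgeSet → ∀ (t : Fin k) (E : Set (Fin k × (Fin n → 𝒵 e))),
        (Measure.pi fun _ : Fin n => edgeLaw μ V Z e).real
            {x | (h fun i => (x i).1, fun i => (x i).2) ∈ E} ≤
          (Measure.pi fun _ : Fin n => edgeLaw μ V Z e).real
            {x | ((h fun i => (x i).1) + t, fun i => (x i).2) ∈ E} + δ n := by
    intro e
    by_cases he : (e : Sym2 (Fin m)) ∈ T.edgeSet
    · have h1 := hR e he
      rw [condEntropy_edge μ hV hZ hpair] at h1
      obtain ⟨c, hc1, hc2⟩ := exists_between h1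
      have hct : c ≠ ∞ := ne_top_of_lt hc2
      rw [← ENNReal.ofReal_toReal hct] at hc1 hc2
      obtain ⟨δ, h2, h3, h4⟩ := exists_tendsto_hash (edgeLaw μ V Z e)
        (ENNReal.ofReal_lt_ofReal_iff'.1 hc1).1 hc2
      refine ⟨δ, h2, h3, fun n k _ hk => ?_⟩
      obtain ⟨h, hh⟩ := h4 n k hk
      exact ⟨h, fun _ => hh⟩
    · exact ⟨fun _ => 0, fun _ => le_rfl, tendsto_const_nhds,
        fun n k _ _ => ⟨fun _ => 0, fun h => absurd h he⟩⟩
  choose δ hδ0 hδlim hδh using hδ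
  have hpos : ∀ n : ℕ, (0 : ℝ) < 1 / (n + 1) := fun n => by positivity
  set ε : ℕ → ℝ := fun n => 1 / (n + 1) with hεdef
  set σ : ℕ → ℝ := fun n => ∑ e, δ e n + 1 / (n + 1) with hσdef
  have hεlim : Tendsto ε atTop (𝓝 0) := tendsto_one_div_add_atTop_nhds_zero_nat
  have hσlim : Tendsto σ atTop (𝓝 0) := by
    simpa using (tendsto_finsetSum Finset.univ fun e _ => hδlim e).add hεlim
  have hσpos : ∀ n, 0 < σ n := fun n =>
    add_pos_of_nonneg_of_pos (Finset.sum_nonneg fun e _ => hδ0 e n) (hpos n)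
  have hadm : (∀ n, 0 < ε n) ∧ (∀ n, 0 < σ n) ∧ Tendsto (fun n => ε n + σ n) atTop (𝓝 0) :=
    ⟨hpos, hσpos, by simpa using hεlim.add hσlim⟩
  refine le_trans ?_ (le_iSup_of_le ε (le_iSup_of_le σ (le_iSup_of_le hadm le_rfl)))
  have hkey : ∀ n : ℕ, ENNReal.ofReal ⌊R * n⌋₊ ≤
      maxKeyLength μ (terminalVar G V) (fun ω e => Z e ω) A n (ε n) (σ n) := by
    intro n
    -- A power of two makes the key length exactly `⌊R n⌋`.
    set k := 2 ^ ⌊R * n⌋₊ with hk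
    have hkR : (k : ℝ) ≤ 2 ^ (n * R) := by
      rw [hk, Nat.cast_pow, Nat.cast_ofNat, ← Real.rpow_natCast]
      refine Real.rpow_le_rpow_of_exponent_le one_le_two ?_
      rw [mul_comm]
      exact Nat.floor_le (by positivity)
    have hlog : Real.logb 2 k = ⌊R * n⌋₊ := by
      rw [hk, Nat.cast_pow, Nat.cast_ofNat, ← Real.rpow_natCast,
        Real.logb_rpow two_pos (by norm_num)]
    have : NeZero k := ⟨by positivity⟩
    choose h hh using fun e => hδh e n k hkR
    refine le_iSup₂_of_le k ⟨Nat.one_le_two_pow, exists_isSecretKey μ hV hZ hpair hT hA hab h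
      (fun e => hδ0 e n) hh (hpos n).le (le_add_of_nonneg_right (hpos n).le)⟩ ?_
    rw [hlog]
  have hlim : Tendsto (fun n : ℕ => ENNReal.ofReal (⌊R * n⌋₊ / n)) atTop (𝓝 (ENNReal.ofReal R)) :=
    ENNReal.tendsto_ofReal
      ((tendsto_nat_floor_mul_div_atTop hR0).comp tendsto_natCast_atTop_atTop)
  rw [← hlim.liminf_eq]
  refine liminf_le_liminf ?_
  filter_upwards [eventually_gt_atTop 0] with n hn
  have hn' : (0 : ℝ) < n := by exact_mod_cast hn
  rw [ENNReal.ofReal_div_of_pos hn', ENNReal.ofReal_natCast (n := n)]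
  exact ENNReal.div_le_div_right (hkey n) _

end Capacity

/-- As `A` has two elements, every terminal in `A` lies on an edge of `T`. -/
theorem exists_adj_of_mem {m : ℕ} {G : SimpleGraph (Fin m)} {A : Finset (Fin m)} {T : G.Subgraph}
    (hT : T.coe.IsTree) (hAT : (A : Set (Fin m)) ⊆ T.verts) (hA : 2 ≤ A.card) :
    ∀ j ∈ A, ∃ u, T.Adj j u := by
  intro j hj
  obtain ⟨j', hj', hne⟩ := Finset.exists_mem_ne (by omega : 1 < A.card) j
  have h := (SimpleGraph.reachable_iff_reflTransGen _ _).1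
    (hT.1.preconnected ⟨j, hAT hj⟩ ⟨j', hAT hj'⟩)
  rcases Relation.ReflTransGen.cases_head h with h | ⟨w, hw, -⟩
  · exact absurd (congrArg Subtype.val h).symm hne
  · exact ⟨w, hw⟩

end TreePIN

theorem theorem2 {m : ℕ} (G : SimpleGraph (Fin m)) [Fintype G.edgeSet]
    {Ω : Type*} [MeasurableSpace Ω] (μ : Measure Ω) [IsProbabilityMeasure μ]
    {𝒱 𝒵 : G.edgeSet → Type*}
    [∀ e, Countable (𝒱 e)] [∀ e, MeasurableSpace (𝒱 e)] [∀ e, MeasurableSingletonClass (𝒱 e)]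
    [∀ e, Countable (𝒵 e)] [∀ e, MeasurableSpace (𝒵 e)] [∀ e, MeasurableSingletonClass (𝒵 e)]
    (V : (e : G.edgeSet) → Ω → 𝒱 e) (Z : (e : G.edgeSet) → Ω → 𝒵 e)
    (hV : ∀ e, Measurable (V e)) (hZ : ∀ e, Measurable (Z e))
    (hPIN : TreePIN.IsWiretappedTreePIN G μ V Z)
    (A : Finset (Fin m)) (hA : 2 ≤ A.card)
    (T : G.Subgraph) (hT : TreePIN.IsSmallestSubtree G A T) :
    IsLeast
      {h : ℝ≥0∞ | ∃ e : G.edgeSet, (e : Sym2 (Fin m)) ∈ T.edgeSet ∧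
        h = TreePIN.condEntropy μ (V e) (fun ω e' => Z e' ω)}
      (TreePIN.wskCapacity μ (TreePIN.terminalVar G V) (fun ω e => Z e ω) A) := by
  have hpair := TreePIN.measure_pairs_eq_prod μ hV hZ hPIN.indep hPIN.factor
  have hconv : ∀ e : G.edgeSet, (e : Sym2 (Fin m)) ∈ T.edgeSet →
      TreePIN.wskCapacity μ (TreePIN.terminalVar G V) (fun ω e => Z e ω) A ≤
        TreePIN.condEntropy μ (V e) (fun ω e' => Z e' ω) := by
    rintro ⟨e, he⟩ heT
    induction e using Sym2.ind with
    | _ a b =>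
      obtain ⟨L, h₁, h₂, h₃⟩ := TreePIN.exists_separating_set hPIN.isTree hT
        (SimpleGraph.Subgraph.mem_edgeSet.1 heT)
      exact TreePIN.wskCapacity_le μ hV hZ hpair _ h₃ h₁ h₂
  have hadj := TreePIN.exists_adj_of_mem hT.isTree hT.subset hA
  obtain ⟨j, hj⟩ := Finset.card_pos.1 (by omega : 0 < A.card)
  obtain ⟨u, hu⟩ := hadj j hj
  obtain ⟨e, heT, hmin⟩ := Set.exists_min_image {e : G.edgeSet | (e : Sym2 (Fin m)) ∈ T.edgeSet}
    (fun e => TreePIN.condEntropy μ (V e) (fun ω e' => Z e' ω)) (Set.toFinite _)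
    ⟨⟨s(j, u), T.adj_sub hu⟩, hu⟩
  refine ⟨⟨e, heT, le_antisymm (hconv e heT) (le_of_forall_lt fun c hc => ?_)⟩, ?_⟩
  · obtain ⟨c', hc1, hc2⟩ := exists_between hc
    rw [← ENNReal.ofReal_toReal (ne_top_of_lt hc2)] at hc1 hc2
    exact hc1.trans_le (TreePIN.ofReal_le_wskCapacity μ hV hZ hpair hT.isTree hadj hu
      ENNReal.toReal_nonneg fun e' he' => hc2.trans_le (hmin e' he'))
  · rintro _ ⟨e', he', rfl⟩
    exact hconv e' he'
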